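/- **Setting.** Let $H\neq\{0\}$ be a finite-dimensional (real or complex) vector space with two inner products $\langle\cdot,\cdot\rangle_0$, $\langle\cdot,\cdot\rangle_1$; write $\|\cdot\|_0$ for the norm of the first one and for the corresponding operator norm. For $f\in H$ let $Tf\in H$ be the unique solution of $\langle Tf,\phi\rangle_1=\langle f,\phi\rangle_0$ for all $\phi\in H$; for $t\ge 0$ let $u=T_1(t)f\in H$ be the unique solution of $\langle u,\phi\rangle_0+t^2\langle u,\phi\rangle_1=\langle f,\phi\rangle_0$ for all $\phi\in H$, and put $T_2(t)=t^{-2}T_1(t^{-1})$ for $t>0$. $T$ is symmetric positive definite with respect to $\langle\cdot,\cdot\rangle_0$; let $\mu$ be its largest eigenvalue and $T^\beta f=\sum_i\mu_i^\beta\langle f,\psi_i\rangle_0\psi_i$, where $(\psi_i)$ is a $\langle\cdot,\cdot\rangle_0$-orthonormal basis with $T\psi_i=\mu_i\psi_i$. Let $0<\beta<1$, $C_\beta=\int_0^\infty t^{2\beta-1}(1+t^2)^{-1}\,dt$, $N\ge 1$ an integer, $k=1/\sqrt N$, and let $\rho(\theta)=2^\theta-1$ for $\theta>1$, $\rho(\theta)=1$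 for $\theta\le 1$. **The three quadratures.** * (Rectangle rule, graded meshes.) For $0\le i<N$ let $s_{1,i}$ be any point of $\big((i/N)^{1/(2\beta)},((i+1)/N)^{1/(2\beta)}\big]$ and $s_{2,i}$ any point of $\big((i/N)^{1/(2-2\beta)},((i+1)/N)^{1/(2-2\beta)}\big]$, and put $$Q_R=\frac1{2NC_\beta}\sum_{i=0}^{N-1}\big[\beta^{-1}T_1(s_{1,i})+(1-\beta)^{-1}T_2(s_{2,i})\big].$$ * (Gaussian rule, dyadic partition.) For an integer $r\ge 1$ let $M=\lceil r\log_2 N/\min(\beta,1-\beta)\rceil$. For $1\le i\le M$ divide $[2^{-i},2^{-i+1}]$ into $N$ intervals $I_{i,j}$, $1\le j\le N$, of equal length. Let $t^{1,m}_{i,j},A^{1,m}_{i,j}$ (resp. $t^{2,m}_{i,j},A^{2,m}_{i,j}$), $1\le m\le r$, be the nodes and weights of the $r$-point Gaussian rule on $I_{i,j}$ with weight function $t^{2\beta-1}$ (resp. $t^{1-2\beta}$), that is, the rule with $r$ distinct nodes in $I_{i,j}$ which is exact for all polynomials of degree at most $2r-1$; such rules exist. Put $$Q_G=\frac1{C_\beta}\sum_{i=1}^M\sum_{j=1}^N\sum_{m=1}^r\big(A^{1,m}_{i,j}T_1(t^{1,m}_{i,j})+A^{2,m}_{i,j}T_2(t^{2,m}_{i,j})\big).$$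 * (Trapezoidal rule in $y=\ln t$.) $$Q_E=\frac k{C_\beta}\sum_{\ell=-N}^N e^{2\beta y_\ell}\,T_1(e^{y_\ell}),\qquad y_\ell=\ell k.$$ **Theorem.** For every integer $r\ge1$ there is a constant $C_G=C_G(r)$ depending only on $r$ such that, for all $H$, $\langle\cdot,\cdot\rangle_0$, $\langle\cdot,\cdot\rangle_1$, $\beta$, $N$ and all choices of the points $s_{1,i},s_{2,i}$ as above, $$\|T^\beta-Q_R\|_0\le B_R:=\frac{2+\rho\big(\tfrac1{2\beta}\big)\pi}{2C_\beta N\beta}+\frac{\mu\big(2+\rho\big(\tfrac1{2-2\beta}\big)\pi\big)}{2C_\beta N(1-\beta)},$$ $$\|T^\beta-Q_G\|_0\le B_G:=\frac{C_G}{C_\beta}\Big(\frac1{2\beta}+\frac{\mu}{2(1-\beta)}\Big)N^{-2r},$$ $$\|T^\beta-Q_E\|_0\le B_E:=\frac1{C_\beta}\Big[\frac{N(D_S)}{2\sinh(\pi^2/(4k))}e^{-\pi^2/(4k)}+\frac1{2\beta}e^{-2\beta/k}+\frac{\mu}{2-2\beta}e^{-(2-2\beta)/k}\Big],$$ where, with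 $g_\lambda(z)=e^{2\beta z}(1+e^{2z}\lambda)^{-1}$, $$N(D_S)=\max_{\lambda\ge 1/\mu}\int_{-\infty}^\infty\big(|g_\lambda(y-i\pi/4)|+|g_\lambda(y+i\pi/4)|\big)\,dy\le\frac1\beta+\frac{\mu}{1-\beta},$$ the maximum being attained. -/

import Mathlib

noncomputable section

namespace FractionalQuadrature

open MeasureTheory

/-! ### The solution operators

`H` with its inner product-space structure carries the inner product `⟨·,·⟩₀` and the norm `‖·‖₀`;
the second inner product `⟨·,·⟩₁` is an `InnerProductSpace.Core 𝕜 H`.  Mathlib's inner products are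
linear in the second variable. -/

section Operators

variable {𝕜 : Type*} [RCLike 𝕜] {H : Type*} [NormedAddCommGroup H] [InnerProductSpace 𝕜 H]

/-- The inner product `⟨u,v⟩₀ + t² ⟨u,v⟩₁` on `H`. -/
@[reducible]
def shiftedInner (ip₁ : InnerProductSpace.Core 𝕜 H) (t : ℝ) : InnerProductSpace.Core 𝕜 H where
  inner u v := Inner.inner 𝕜 u v + ((t ^ 2 : ℝ) : 𝕜) * ip₁.inner u v
  conj_inner_symm u v := by
    simp only [map_add, map_mul, RCLike.conj_ofReal, inner_conj_symm, ip₁.conj_inner_symm]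
  re_inner_nonneg u := by
    rw [map_add, RCLike.re_ofReal_mul]
    exact add_nonneg inner_self_nonneg (mul_nonneg (sq_nonneg t) (ip₁.re_inner_nonneg u))
  add_left u v w := by
    rw [inner_add_left, ip₁.add_left]; ring
  smul_left u v r := by
    rw [inner_smul_left, ip₁.smul_left]; ring
  definite u hu := by
    have h : RCLike.re (Inner.inner 𝕜 u u + ((t ^ 2 : ℝ) : 𝕜) * ip₁.inner u u) = 0 := by
      rw [hu, map_zero]
    rw [map_add, RCLike.re_ofReal_mul] at h
    have h1 := mul_nonneg (sq_nonneg t) (ip₁.re_inner_nonneg u)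
    have h2 : 0 ≤ RCLike.re (Inner.inner 𝕜 u u) := inner_self_nonneg
    have h3 : RCLike.re (Inner.inner 𝕜 u u) = 0 := by linarith
    rw [inner_self_eq_norm_sq] at h3
    exact norm_eq_zero.1 (pow_eq_zero_iff two_ne_zero |>.1 h3)

theorem core_add_right (c : InnerProductSpace.Core 𝕜 H) (x y z : H) :
    c.inner x (y + z) = c.inner x y + c.inner x z := by
  rw [← c.conj_inner_symm, c.add_left, map_add, c.conj_inner_symm, c.conj_inner_symm]

theorem core_smul_right (c : InnerProductSpace.Core 𝕜 H) (x y : H) (r : 𝕜) :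
    c.inner x (r • y) = r * c.inner x y := by
  rw [← c.conj_inner_symm, c.smul_left, map_mul, c.conj_inner_symm, RCLike.conj_conj]

theorem core_unique (c : InnerProductSpace.Core 𝕜 H) {u v : H}
    (h : ∀ φ, c.inner φ u = c.inner φ v) : u = v := by
  have h1 : c.inner (u - v) (u - v) = 0 := by
    have h2 : u - v = u + (-1 : 𝕜) • v := by rw [neg_one_smul, sub_eq_add_neg]
    have h3 : c.inner (u - v) (u + (-1 : 𝕜) • v) = 0 := by
      rw [core_add_right, core_smul_right, h]; ring
    rwa [← h2] at h3
  exact sub_eq_zero.1 (c.definite _ h1)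

variable [FiniteDimensional 𝕜 H]

theorem exists_solution (c : InnerProductSpace.Core 𝕜 H) (f : H) :
    ∃ u : H, ∀ φ : H, c.inner φ u = Inner.inner 𝕜 φ f := by
  let b := stdOrthonormalBasis 𝕜 H
  let A : H →ₗ[𝕜] H :=
    { toFun := fun u => ∑ i, c.inner (b i) u • b i
      map_add' := fun u v => by
        simp only [core_add_right, add_smul, Finset.sum_add_distrib]
      map_smul' := fun r u => by
        simp only [core_smul_right, mul_smul, Finset.smul_sum, RingHom.id_apply] }
  have hA : ∀ φ u : H, Inner.inner 𝕜 φ (A u) = c.inner φ u := by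
    intro φ u
    let B : H →ₗ[𝕜] 𝕜 :=
      { toFun := fun φ => c.inner u φ
        map_add' := core_add_right c u
        map_smul' := fun r φ => core_smul_right c u φ r }
    have h1 : B φ = ∑ i, Inner.inner 𝕜 (b i) φ * B (b i) := by
      conv_lhs => rw [← b.sum_repr' φ]
      simp [map_sum]
    have h2 : Inner.inner 𝕜 φ (A u) = ∑ i, c.inner (b i) u * Inner.inner 𝕜 φ (b i) := by
      simp only [A, LinearMap.coe_mk, AddHom.coe_mk, inner_sum, inner_smul_right]
    have h3 : c.inner φ u = (starRingEnd 𝕜) (B φ) := (c.conj_inner_symm φ u).symm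
    rw [h3, h1, h2, map_sum]
    refine Finset.sum_congr rfl fun i _ => ?_
    rw [map_mul, inner_conj_symm]
    have h4 : (starRingEnd 𝕜) (B (b i)) = c.inner (b i) u := c.conj_inner_symm (b i) u
    rw [h4]; ring
  have hinj : Function.Injective A := by
    intro u v huv
    refine core_unique c fun φ => ?_
    rw [← hA, ← hA, huv]
  obtain ⟨u, hu⟩ := LinearMap.injective_iff_surjective.1 hinj f
  exact ⟨u, fun φ => by rw [← hA, hu]⟩

/-- The solution operator of an inner product `c` on `H`: it maps `f` to the unique `u` in `H` with
`c(u, φ) = ⟨f, φ⟩₀` for all `φ` in `H`. -/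
def solve (c : InnerProductSpace.Core 𝕜 H) : H →ₗ[𝕜] H where
  toFun f := Classical.choose (exists_solution c f)
  map_add' f g := by
    refine core_unique c fun φ => ?_
    rw [Classical.choose_spec (exists_solution c (f + g)) φ, core_add_right,
      Classical.choose_spec (exists_solution c f) φ,
      Classical.choose_spec (exists_solution c g) φ, inner_add_right]
  map_smul' r f := by
    refine core_unique c fun φ => ?_
    rw [Classical.choose_spec (exists_solution c (r • f)) φ, RingHom.id_apply, core_smul_right,
      Classical.choose_spec (exists_solution c f) φ, inner_smul_right]

theorem solve_spec (c : InnerProductSpace.Core 𝕜 H) (f φ : H) :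
    c.inner φ (solve c f) = Inner.inner 𝕜 φ f :=
  Classical.choose_spec (exists_solution c f) φ

/-- The operator `T`: `⟨T f, φ⟩₁ = ⟨f, φ⟩₀` for all `φ`. -/
def opT (ip₁ : InnerProductSpace.Core 𝕜 H) : H →ₗ[𝕜] H := solve ip₁

/-- The operator `T₁(t)`: `u = T₁(t) f` satisfies `⟨u, φ⟩₀ + t² ⟨u, φ⟩₁ = ⟨f, φ⟩₀` for all `φ`. -/
def opT₁ (ip₁ : InnerProductSpace.Core 𝕜 H) (t : ℝ) : H →ₗ[𝕜] H := solve (shiftedInner ip₁ t)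

/-- The operator `T₂(t) = t⁻² T₁(t⁻¹)` (used for `t > 0` only). -/
def opT₂ (ip₁ : InnerProductSpace.Core 𝕜 H) (t : ℝ) : H →ₗ[𝕜] H :=
  (((t ^ 2)⁻¹ : ℝ) : 𝕜) • opT₁ ip₁ t⁻¹

theorem opT_isSymmetric (ip₁ : InnerProductSpace.Core 𝕜 H) : (opT ip₁).IsSymmetric := by
  intro f g
  have h1 := solve_spec ip₁ g (solve ip₁ f)
  have h2 := solve_spec ip₁ f (solve ip₁ g)
  change Inner.inner 𝕜 (solve ip₁ f) g = Inner.inner 𝕜 f (solve ip₁ g)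
  rw [← inner_conj_symm f, ← h1, ← h2, ip₁.conj_inner_symm]

/-- The fractional power `T^β f = ∑ᵢ μᵢ^β ⟨f, ψᵢ⟩₀ ψᵢ`, where `(ψᵢ)` is a `⟨·,·⟩₀`-orthonormal basis
of eigenvectors of `T` and `(μᵢ)` are the corresponding (positive) eigenvalues. -/
def powT (ip₁ : InnerProductSpace.Core 𝕜 H) (β : ℝ) : H →ₗ[𝕜] H :=
  ∑ i, ((((opT_isSymmetric ip₁).eigenvalues rfl i) ^ β : ℝ) : 𝕜) •
    (LinearMap.toSpanSingleton 𝕜 H ((opT_isSymmetric ip₁).eigenvectorBasis rfl i) ∘ₗ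
      (innerₛₗ 𝕜 ((opT_isSymmetric ip₁).eigenvectorBasis rfl i)))

/-- The largest eigenvalue of `T`. -/
def maxEigenvalue (ip₁ : InnerProductSpace.Core 𝕜 H) : ℝ :=
  sSup {μ : ℝ | Module.End.HasEigenvalue (opT ip₁) (μ : 𝕜)}

/-- The operator norm with respect to `‖·‖₀`. -/
def opNorm₀ (A : H →ₗ[𝕜] H) : ℝ := ‖LinearMap.toContinuousLinearMap A‖

end Operators

/-- `C_β = ∫₀^∞ t^{2β-1} (1 + t²)⁻¹ dt`. -/
def Cbeta (β : ℝ) : ℝ := ∫ t in Set.Ioi (0 : ℝ), t ^ (2 * β - 1) * (1 + t ^ 2)⁻¹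

/-! ### Rectangle rule on graded meshes -/

/-- The graded mesh `tᵢ = (i / N)^θ` of `[0, 1]`. -/
def gradedMesh (θ : ℝ) (N i : ℕ) : ℝ := ((i : ℝ) / N) ^ θ

/-- `s i` is an arbitrary point of the cell `(tᵢ, tᵢ₊₁]` of the graded mesh, for `0 ≤ i < N`. -/
def IsSampling (θ : ℝ) (N : ℕ) (s : ℕ → ℝ) : Prop :=
  ∀ i < N, s i ∈ Set.Ioc (gradedMesh θ N i) (gradedMesh θ N (i + 1))

/-- The function `ρ(θ)`, equal to `2^θ - 1` for `θ > 1` and to `1` for `θ ≤ 1`. -/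
def rho (θ : ℝ) : ℝ := if 1 < θ then 2 ^ θ - 1 else 1

/-! ### Weighted Gaussian quadrature on a dyadic partition -/

/-- The `r`-point Gaussian quadrature rule with weight `w` on `[a, b]`: nodes `t 0 < ⋯ < t (r-1)` in
`[a, b]` and weights `A`, exact for all polynomials of degree at most `2r - 1`. -/
def IsGaussRule (w : ℝ → ℝ) (a b : ℝ) (r : ℕ) (t A : Fin r → ℝ) : Prop :=
  StrictMono t ∧ (∀ k, t k ∈ Set.Icc a b) ∧
    ∀ p : Polynomial ℝ, p.natDegree < 2 * r →
      ∑ k, A k * p.eval (t k) = ∫ x in a..b, w x * p.eval x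

/-- The `j`-th (`j = 0, …, N`) of the points that divide `[2^{-i}, 2^{-i+1}]` into `N` subintervals
of equal length `1 / (2^i N)`. -/
def dyadicPoint (N i j : ℕ) : ℝ := (2 ^ i)⁻¹ * (1 + (j : ℝ) / N)

/-- The number `M = ⌈r log₂ N / min(β, 1-β)⌉` of dyadic intervals. -/
def dyadicLevels (β : ℝ) (r N : ℕ) : ℕ := ⌈(r : ℝ) * Real.logb 2 N / min β (1 - β)⌉₊

/-- `t i j` and `A i j` are the nodes and weights of the `r`-point Gaussian rule with weight `w` on
the `j`-th subinterval of `[2^{-i}, 2^{-i+1}]`, for `1 ≤ i ≤ M` and `1 ≤ j ≤ N`. -/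
def IsDyadicGauss (w : ℝ → ℝ) (M N r : ℕ) (t A : ℕ → ℕ → Fin r → ℝ) : Prop :=
  ∀ i ∈ Finset.Icc 1 M, ∀ j ∈ Finset.Icc 1 N,
    IsGaussRule w (dyadicPoint N i (j - 1)) (dyadicPoint N i j) r (t i j) (A i j)

/-! ### Trapezoidal rule in `y = ln t` -/

/-- The function `g_λ(z) = e^{2βz} (1 + e^{2z} λ)⁻¹`. -/
def gFun (β lam : ℝ) (z : ℂ) : ℂ := Complex.exp (2 * β * z) * (1 + Complex.exp (2 * z) * lam)⁻¹

/-- `∫_ℝ (|g_λ(y - iπ/4)| + |g_λ(y + iπ/4)|) dy`. -/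
def stripIntegral (β lam : ℝ) : ℝ :=
  ∫ y : ℝ, (‖gFun β lam (y - Complex.I * (Real.pi / 4))‖ +
    ‖gFun β lam (y + Complex.I * (Real.pi / 4))‖)

/-- `N(D_S)`, the maximum of the above integrals over `λ ≥ λ₀`. -/
def NDS (β lam₀ : ℝ) : ℝ := sSup (stripIntegral β '' Set.Ici lam₀)

/-! ### The three quadrature approximations of `T^β` and their error bounds -/

section Quadratures

variable {𝕜 : Type*} [RCLike 𝕜] {H : Type*} [NormedAddCommGroup H] [InnerProductSpace 𝕜 H]
  [FiniteDimensional 𝕜 H]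

/-- `Q_R = 1/(2 N C_β) ∑ᵢ (β⁻¹ T₁(s₁ᵢ) + (1-β)⁻¹ T₂(s₂ᵢ))`. -/
def QR (ip₁ : InnerProductSpace.Core 𝕜 H) (β : ℝ) (N : ℕ) (s₁ s₂ : ℕ → ℝ) : H →ₗ[𝕜] H :=
  ((1 / (2 * N * Cbeta β) : ℝ) : 𝕜) •
    ∑ i ∈ Finset.range N,
      (((β⁻¹ : ℝ) : 𝕜) • opT₁ ip₁ (s₁ i) + (((1 - β)⁻¹ : ℝ) : 𝕜) • opT₂ ip₁ (s₂ i))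

/-- `Q_G = 1/C_β ∑ᵢ ∑ⱼ ∑ₖ (A¹ᵢⱼₖ T₁(t¹ᵢⱼₖ) + A²ᵢⱼₖ T₂(t²ᵢⱼₖ))`. -/
def QG (ip₁ : InnerProductSpace.Core 𝕜 H) (β : ℝ) (M N r : ℕ)
    (t₁ A₁ t₂ A₂ : ℕ → ℕ → Fin r → ℝ) : H →ₗ[𝕜] H :=
  ((1 / Cbeta β : ℝ) : 𝕜) •
    ∑ i ∈ Finset.Icc 1 M, ∑ j ∈ Finset.Icc 1 N, ∑ k : Fin r,
      ((A₁ i j k : 𝕜) • opT₁ ip₁ (t₁ i j k) + (A₂ i j k : 𝕜) • opT₂ ip₁ (t₂ i j k))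

/-- The mesh size `k = 1 / √N`. -/
def meshSize (N : ℕ) : ℝ := 1 / Real.sqrt N

/-- `Q_E = k/C_β ∑_{ℓ=-N}^{N} e^{2βy_ℓ} T₁(e^{y_ℓ})` with `y_ℓ = ℓ k`; here
`T₁(e^{y}) = (I + e^{2y} T⁻¹)⁻¹`. -/
def QE (ip₁ : InnerProductSpace.Core 𝕜 H) (β : ℝ) (N : ℕ) : H →ₗ[𝕜] H :=
  ((meshSize N / Cbeta β : ℝ) : 𝕜) •
    ∑ l ∈ Finset.Icc (-(N : ℤ)) (N : ℤ),
      ((Real.exp (2 * β * (l * meshSize N)) : ℝ) : 𝕜) • opT₁ ip₁ (Real.exp (l * meshSize N))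

end Quadratures

def BR (β μ : ℝ) (N : ℕ) : ℝ :=
  (2 + rho ((2 * β)⁻¹) * Real.pi) / (2 * Cbeta β * N * β) +
    μ * (2 + rho ((2 - 2 * β)⁻¹) * Real.pi) / (2 * Cbeta β * N * (1 - β))

def BG (C β μ : ℝ) (r N : ℕ) : ℝ :=
  C / Cbeta β * (1 / (2 * β) + μ / (2 * (1 - β))) * ((N : ℝ) ^ (2 * r))⁻¹

def BE (β μ : ℝ) (N : ℕ) : ℝ :=
  1 / Cbeta β *
    (NDS β (μ⁻¹) / (2 * Real.sinh (Real.pi ^ 2 / (4 * meshSize N))) *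
        Real.exp (-(Real.pi ^ 2 / (4 * meshSize N))) +
      1 / (2 * β) * Real.exp (-(2 * β / meshSize N)) +
      μ / (2 - 2 * β) * Real.exp (-((2 - 2 * β) / meshSize N)))

end FractionalQuadrature

end

open FractionalQuadrature

universe u v

/-!
In a `⟨·,·⟩₀`-orthonormal eigenbasis of `T` all operators are diagonal: on an eigenvector with
eigenvalue `m`, `T^β` acts as `m^β`, `T₁(t)` as `(1 + t²/m)⁻¹` and `T₂(t)` as `(t² + 1/m)⁻¹`. So the
operator norms are bounded by scalar quadrature errors, uniformly in `0 < m ≤ μ`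
(`opNorm₀_powT_sub_le`). The scalar identity behind the quadratures is the Balakrishnan formula

`m^β C_β = ∫₀^∞ t^{2β-1} (1 + t²/m)⁻¹ dt
        = ∫₀¹ t^{2β-1} (1 + t²/m)⁻¹ dt + ∫₀¹ t^{1-2β} (t² + 1/m)⁻¹ dt`

(`integral_Ioi_eq_rpow_mul_Cbeta`, `rpow_mul_Cbeta_eq_add`). Both integrals over `(0, 1)` have the
form `∫₀¹ t^{p-1} f(t) dt` with `p = 2β`, `p = 2 - 2β`.

* Rectangle rule. The cells of the graded mesh have equal mass `1 / (pN)` and `f` is antitone, so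
  the cell errors telescope to at most `f(0) / (pN)` (`abs_rectangle_error_le`). This is already
  smaller than the asserted bound, which has additional nonnegative terms with `π ρ`.
* Gaussian rule. The rules exist because an orthogonal polynomial for a positive functional has
  simple roots inside the interval (`exists_gauss_nodes_weights`). Their weights are nonnegative, so
  the error is at most twice the best polynomial approximation error times the mass
  (`IsGaussRule.abs_error_le`). Up to a factor, `f(t) = a² / (t² + a²) = a Im (t - ia)⁻¹`, and the
  geometric series about the left endpoint of a dyadic cell converges with ratio at most `1 / N`,
  uniformly in `a` (`exists_polynomial_approx`). The choice of the number of levels makes the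
  omitted integral near `0` comparable; in total the constant `3` works for every `r`
  (`abs_dyadicGauss_error_le`).
* Trapezoidal rule. After `t = e^y` the integrand is `g_λ`, `λ = 1/m`, holomorphic on
  `|Im z| ≤ π/4` and exponentially decaying there. Poisson summation writes the error of the infinite
  trapezoidal sum as a sum of Fourier coefficients, and moving the line of integration by `± π/4`
  bounds these (`IsStripDecaying.norm_integral_sub_trapezoid_le`). The omitted terms form geometric
  tails (`mul_tsum_tail_le`). On the lines `Im z = ± π/4` one has `|1 + λ e^{2z}|² = 1 + λ² e^{4y}`,
  so the strip integral decreases in `λ` and its maximum is at the left end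
  (`isGreatest_stripIntegral`).
-/

namespace FractionalQuadrature

open MeasureTheory

/-! ### Diagonalization of the solution operators -/

section Diagonal

variable {𝕜 : Type*} [RCLike 𝕜] {H : Type*} [NormedAddCommGroup H] [InnerProductSpace 𝕜 H]
  [FiniteDimensional 𝕜 H]

theorem opT_eigenvector (ip₁ : InnerProductSpace.Core 𝕜 H) (i : Fin (Module.finrank 𝕜 H)) :
    opT ip₁ ((opT_isSymmetric ip₁).eigenvectorBasis rfl i) =
      (((opT_isSymmetric ip₁).eigenvalues rfl i : ℝ) : 𝕜) •
        (opT_isSymmetric ip₁).eigenvectorBasis rfl i :=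
  (opT_isSymmetric ip₁).apply_eigenvectorBasis rfl i

/-- For a unit eigenvector `ψ` of `T` with eigenvalue `m`, `⟨Tψ, Tψ⟩₁ = m`. -/
theorem eigenvalues_opT_pos (ip₁ : InnerProductSpace.Core 𝕜 H) (i : Fin (Module.finrank 𝕜 H)) :
    0 < (opT_isSymmetric ip₁).eigenvalues rfl i := by
  have hψ := opT_eigenvector ip₁ i
  have hn := ((opT_isSymmetric ip₁).eigenvectorBasis rfl).orthonormal.1 i
  generalize (opT_isSymmetric ip₁).eigenvectorBasis rfl i = ψ at hψ hn
  generalize (opT_isSymmetric ip₁).eigenvalues rfl i = m at hψ ⊢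
  have hs := solve_spec ip₁ ψ
  change ∀ φ, ip₁.inner φ (opT ip₁ ψ) = _ at hs
  have h1 : ip₁.inner (opT ip₁ ψ) (opT ip₁ ψ) = (m : 𝕜) := by
    rw [hs, hψ, inner_smul_left, inner_self_eq_norm_sq_to_K, hn]
    simp
  have h2 := ip₁.re_inner_nonneg (opT ip₁ ψ)
  rw [h1, RCLike.ofReal_re] at h2
  refine lt_of_le_of_ne h2 fun h0 => ?_
  rw [← h0, RCLike.ofReal_zero] at h1
  have h3 := hs ψ
  rw [ip₁.definite _ h1, inner_self_eq_norm_sq_to_K, hn] at h3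
  have h4 := core_smul_right ip₁ ψ 0 0
  simp only [smul_zero, zero_mul] at h4
  simp [h4] at h3

theorem opT₁_apply_of_eigenvector (ip₁ : InnerProductSpace.Core 𝕜 H) {m : ℝ} (hm : 0 < m) {ψ : H}
    (hψ : opT ip₁ ψ = (m : 𝕜) • ψ) (t : ℝ) :
    opT₁ ip₁ t ψ = (((1 + t ^ 2 * m⁻¹)⁻¹ : ℝ) : 𝕜) • ψ := by
  refine core_unique (shiftedInner ip₁ t) fun φ => ?_
  have h1 : (shiftedInner ip₁ t).inner φ (opT₁ ip₁ t ψ) = _ := solve_spec (shiftedInner ip₁ t) ψ φ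
  have h2 : ip₁.inner φ (opT ip₁ ψ) = inner 𝕜 φ ψ := solve_spec ip₁ ψ φ
  rw [hψ, core_smul_right] at h2
  rw [h1, core_smul_right]
  change _ = _ * (inner 𝕜 φ ψ + ((t ^ 2 : ℝ) : 𝕜) * ip₁.inner φ ψ)
  rw [← h2]
  have hm' : (m : 𝕜) ≠ 0 := by exact_mod_cast hm.ne'
  have h3 : (((1 + t ^ 2 * m⁻¹) : ℝ) : 𝕜) ≠ 0 := by
    have : 0 < 1 + t ^ 2 * m⁻¹ := by positivity
    exact_mod_cast this.ne'
  rw [RCLike.ofReal_inv, eq_inv_mul_iff_mul_eq₀ h3]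
  push_cast
  field_simp

theorem opT₂_apply_of_eigenvector (ip₁ : InnerProductSpace.Core 𝕜 H) {m : ℝ} (hm : 0 < m) {ψ : H}
    (hψ : opT ip₁ ψ = (m : 𝕜) • ψ) {t : ℝ} (ht : 0 < t) :
    opT₂ ip₁ t ψ = (((t ^ 2 + m⁻¹)⁻¹ : ℝ) : 𝕜) • ψ := by
  rw [opT₂, LinearMap.smul_apply, opT₁_apply_of_eigenvector ip₁ hm hψ, smul_smul,
    ← RCLike.ofReal_mul]
  congr 2
  field_simp

theorem powT_eigenvector (ip₁ : InnerProductSpace.Core 𝕜 H) (β : ℝ)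
    (i : Fin (Module.finrank 𝕜 H)) :
    powT ip₁ β ((opT_isSymmetric ip₁).eigenvectorBasis rfl i) =
      (((opT_isSymmetric ip₁).eigenvalues rfl i ^ β : ℝ) : 𝕜) •
        (opT_isSymmetric ip₁).eigenvectorBasis rfl i := by
  rw [powT, LinearMap.sum_apply, Finset.sum_eq_single i]
  · simp
  · intro j _ hj
    simp [OrthonormalBasis.inner_eq_zero _ hj]
  · simp

/-- The `‖·‖₀`-operator norm of an operator that is diagonal in an orthonormal basis. -/
theorem opNorm₀_le_of_diagonal {ι : Type*} [Fintype ι] (b : OrthonormalBasis ι 𝕜 H)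
    (A : H →ₗ[𝕜] H) (e : ι → ℝ) (hA : ∀ i, A (b i) = (e i : 𝕜) • b i) {B : ℝ} (hB : 0 ≤ B)
    (he : ∀ i, |e i| ≤ B) : opNorm₀ A ≤ B := by
  refine ContinuousLinearMap.opNorm_le_bound _ hB fun f => ?_
  rw [LinearMap.coe_toContinuousLinearMap']
  refine le_of_sq_le_sq ?_ (by positivity)
  have h1 : ∀ i, inner 𝕜 (b i) (A f) = (e i : 𝕜) * inner 𝕜 (b i) f := by
    classical
    intro i
    conv_lhs => rw [← b.sum_repr' f]
    simp only [map_sum, map_smul, hA, inner_sum, inner_smul_right, b.inner_eq_ite, mul_ite, mul_one,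
      mul_zero, Finset.sum_ite_eq, Finset.mem_univ, if_true]
    ring
  rw [← b.sum_sq_norm_inner_right (A f), mul_pow, ← b.sum_sq_norm_inner_right f, Finset.mul_sum]
  refine Finset.sum_le_sum fun i _ => ?_
  rw [h1, norm_mul, mul_pow, RCLike.norm_ofReal]
  gcongr
  exact he i

theorem eigenvalues_le_maxEigenvalue (ip₁ : InnerProductSpace.Core 𝕜 H)
    (i : Fin (Module.finrank 𝕜 H)) :
    (opT_isSymmetric ip₁).eigenvalues rfl i ≤ maxEigenvalue ip₁ := by
  refine le_csSup ?_ ((opT_isSymmetric ip₁).hasEigenvalue_eigenvalues rfl i)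
  have hfin : {μ : 𝕜 | Module.End.HasEigenvalue (opT ip₁) μ}.Finite :=
    Module.End.finite_hasEigenvalue (opT ip₁)
  exact (hfin.preimage (RCLike.ofReal_injective.injOn)).bddAbove

theorem maxEigenvalue_pos [Nontrivial H] (ip₁ : InnerProductSpace.Core 𝕜 H) :
    0 < maxEigenvalue ip₁ :=
  have i : Fin (Module.finrank 𝕜 H) := ⟨0, Module.finrank_pos⟩
  (eigenvalues_opT_pos ip₁ i).trans_le (eigenvalues_le_maxEigenvalue ip₁ i)

end Diagonal

/-! ### The integral representation of the fractional power -/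

section Representation

open Set

theorem integrableOn_rpow_mul_inv {β lam : ℝ} (hβ : 0 < β) (hβ1 : β < 1) (hlam : 0 < lam) :
    IntegrableOn (fun t : ℝ => t ^ (2 * β - 1) * (1 + t ^ 2 * lam)⁻¹) (Ioi 0) := by
  have hm : ∀ s : Set ℝ, AEStronglyMeasurable
      (fun t : ℝ => t ^ (2 * β - 1) * (1 + t ^ 2 * lam)⁻¹) (volume.restrict s) := fun s =>
    Measurable.aestronglyMeasurable (by fun_prop)
  rw [← Ioc_union_Ioi_eq_Ioi (zero_le_one' ℝ)]
  refine IntegrableOn.union ?_ ?_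
  · have h1 : IntegrableOn (fun t : ℝ => t ^ (2 * β - 1)) (Ioc 0 1) :=
      (intervalIntegrable_iff_integrableOn_Ioc_of_le zero_le_one).1
        (intervalIntegral.intervalIntegrable_rpow' (by linarith))
    refine Integrable.mono' h1 (hm _) ((ae_restrict_iff' measurableSet_Ioc).2 (.of_forall ?_))
    intro t ht
    have ht0 := ht.1
    rw [Real.norm_of_nonneg (by positivity)]
    exact mul_le_of_le_one_right (by positivity)
      (inv_le_one_of_one_le₀ (le_add_of_nonneg_right (by positivity)))
  · have h1 : IntegrableOn (fun t : ℝ => lam⁻¹ * t ^ (2 * β - 3)) (Ioi 1) :=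
      (integrableOn_Ioi_rpow_of_lt (by linarith) zero_lt_one).const_mul _
    refine Integrable.mono' h1 (hm _) ((ae_restrict_iff' measurableSet_Ioi).2 (.of_forall ?_))
    intro t ht
    have ht0 : 0 < t := zero_lt_one.trans ht
    rw [Real.norm_of_nonneg (by positivity)]
    have h2 : t ^ (2 * β - 1) = t ^ (2 * β - 3) * t ^ 2 := by
      rw [← Real.rpow_natCast t 2, ← Real.rpow_add ht0]; congr 1; push_cast; ring
    rw [h2, mul_assoc, mul_comm (lam⁻¹)]
    gcongr
    rw [← div_eq_mul_inv, div_le_iff₀ (by positivity)]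
    have : lam⁻¹ * (1 + t ^ 2 * lam) = lam⁻¹ + t ^ 2 := by field_simp
    rw [this]
    exact le_add_of_nonneg_left (by positivity)

theorem Cbeta_pos {β : ℝ} (hβ : 0 < β) (hβ1 : β < 1) : 0 < Cbeta β := by
  have h := integrableOn_rpow_mul_inv hβ hβ1 zero_lt_one
  simp only [mul_one] at h
  rw [Cbeta, setIntegral_pos_iff_support_of_nonneg_ae _ h]
  · have : Ioi (0 : ℝ) ⊆
        Function.support (fun t : ℝ => t ^ (2 * β - 1) * (1 + t ^ 2)⁻¹) ∩ Ioi 0 := by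
      intro t (ht : 0 < t)
      exact ⟨ne_of_gt (by positivity), ht⟩
    exact lt_of_lt_of_le (by simp) (measure_mono this)
  · refine (ae_restrict_iff' measurableSet_Ioi).2 (.of_forall fun t ht => ?_)
    have ht0 : 0 < t := ht
    exact (by positivity : 0 ≤ t ^ (2 * β - 1) * (1 + t ^ 2)⁻¹)

/-- The Balakrishnan formula `∫₀^∞ t^{2β-1} (1 + t²/m)⁻¹ dt = m^β C_β` for a positive scalar. -/
theorem integral_Ioi_eq_rpow_mul_Cbeta {β m : ℝ} (hm : 0 < m) :
    ∫ t in Ioi (0 : ℝ), t ^ (2 * β - 1) * (1 + t ^ 2 * m⁻¹)⁻¹ = m ^ β * Cbeta β := by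
  have hs : 0 < √m := Real.sqrt_pos.2 hm
  have h1 := integral_comp_mul_left_Ioi
    (fun t : ℝ => t ^ (2 * β - 1) * (1 + t ^ 2 * m⁻¹)⁻¹) 0 hs
  rw [mul_zero] at h1
  have h2 : ∫ t in Ioi (0 : ℝ), (√m * t) ^ (2 * β - 1) * (1 + (√m * t) ^ 2 * m⁻¹)⁻¹ =
      √m ^ (2 * β - 1) * Cbeta β := by
    rw [Cbeta, ← integral_const_mul]
    refine setIntegral_congr_fun measurableSet_Ioi fun t ht => ?_
    have ht0 : 0 < t := ht
    rw [Real.mul_rpow hs.le ht0.le, mul_pow, Real.sq_sqrt hm.le, mul_assoc]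
    congr 3
    field_simp
  rw [h2, smul_eq_mul] at h1
  have h3 : m ^ β = √m * √m ^ (2 * β - 1) := by
    rw [mul_comm, ← Real.rpow_add_one hs.ne', Real.sqrt_eq_rpow, ← Real.rpow_mul hm.le]
    congr 1; ring
  rw [h3, mul_assoc, h1, mul_inv_cancel_left₀ hs.ne']

theorem integral_Ioi_one_eq {β lam : ℝ} :
    ∫ t in Ioi (1 : ℝ), t ^ (2 * β - 1) * (1 + t ^ 2 * lam)⁻¹ =
      ∫ t in (0 : ℝ)..1, t ^ (2 - 2 * β - 1) * (t ^ 2 + lam)⁻¹ := by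
  have himg : (fun t : ℝ => t⁻¹) '' Ioo 0 1 = Ioi 1 := by
    rw [Set.image_inv_eq_inv, Set.inv_Ioo_0_left zero_lt_one, inv_one]
  rw [← himg, integral_image_eq_integral_abs_deriv_smul measurableSet_Ioo
    (fun t ht => (hasDerivAt_inv ht.1.ne').hasDerivWithinAt) inv_injective.injOn,
    intervalIntegral.integral_of_le zero_le_one, integral_Ioc_eq_integral_Ioo]
  refine setIntegral_congr_fun measurableSet_Ioo fun t ht => ?_
  have ht0 : 0 < t := ht.1
  simp only [smul_eq_mul]
  rw [abs_neg, abs_of_pos (by positivity), Real.inv_rpow ht0.le, ← Real.rpow_neg ht0.le]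
  have h1 : t ^ (2 - 2 * β - 1) = t ^ (-(2 * β - 1)) := by congr 1; ring
  have h2 : (t ^ 2 + lam)⁻¹ = (t ^ 2)⁻¹ * (1 + t⁻¹ ^ 2 * lam)⁻¹ := by
    rw [← mul_inv]; congr 1; field_simp
  rw [h1, h2]; ring

/-- The two halves `(0, 1)` and `(1, ∞)` of the Balakrishnan integral, the second one reflected
to `(0, 1)` by `t ↦ t⁻¹`. -/
theorem rpow_mul_Cbeta_eq_add {β m : ℝ} (hβ : 0 < β) (hβ1 : β < 1) (hm : 0 < m) :
    m ^ β * Cbeta β = (∫ t in (0 : ℝ)..1, t ^ (2 * β - 1) * (1 + t ^ 2 * m⁻¹)⁻¹) +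
      ∫ t in (0 : ℝ)..1, t ^ (2 - 2 * β - 1) * (t ^ 2 + m⁻¹)⁻¹ := by
  have h := integrableOn_rpow_mul_inv hβ hβ1 (inv_pos.2 hm)
  rw [← integral_Ioi_one_eq, intervalIntegral.integral_of_le zero_le_one,
    ← setIntegral_union (Set.Ioc_disjoint_Ioi le_rfl) measurableSet_Ioi
      (h.mono_set Ioc_subset_Ioi_self) (h.mono_set (Ioi_subset_Ioi zero_le_one)),
    Ioc_union_Ioi_eq_Ioi (zero_le_one' ℝ), integral_Ioi_eq_rpow_mul_Cbeta hm]

theorem intervalIntegrable_rpow_mul {p : ℝ} (hp : 0 < p) {f : ℝ → ℝ} (hf : Continuous f)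
    (a b : ℝ) : IntervalIntegrable (fun t => t ^ (p - 1) * f t) volume a b :=
  (intervalIntegral.intervalIntegrable_rpow' (by linarith)).mul_continuousOn hf.continuousOn

theorem integral_rpow_sub_one {p : ℝ} (hp : 0 < p) (a b : ℝ) :
    ∫ t in a..b, t ^ (p - 1) = (b ^ p - a ^ p) / p := by
  rw [integral_rpow (Or.inl (by linarith))]
  simp

theorem continuous_inv_one_add_sq_mul {lam : ℝ} (hlam : 0 < lam) :
    Continuous fun t : ℝ => (1 + t ^ 2 * lam)⁻¹ :=
  Continuous.inv₀ (by fun_prop) fun t => by positivity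

theorem continuous_inv_sq_add {lam : ℝ} (hlam : 0 < lam) :
    Continuous fun t : ℝ => (t ^ 2 + lam)⁻¹ :=
  Continuous.inv₀ (by fun_prop) fun t => by positivity

theorem antitoneOn_inv_one_add_sq_mul {lam : ℝ} (hlam : 0 < lam) :
    AntitoneOn (fun t : ℝ => (1 + t ^ 2 * lam)⁻¹) (Ici 0) := by
  intro s hs t _ hst
  have hs0 : 0 ≤ s := hs
  simp only
  gcongr

theorem antitoneOn_inv_sq_add {lam : ℝ} (hlam : 0 < lam) :
    AntitoneOn (fun t : ℝ => (t ^ 2 + lam)⁻¹) (Ici 0) := by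
  intro s hs t _ hst
  have hs0 : 0 ≤ s := hs
  simp only
  gcongr

end Representation

/-! ### The rectangle rule on graded meshes -/

section Rectangle

open Set

theorem abs_cell_error_le {p : ℝ} (hp : 0 < p) {f : ℝ → ℝ} (hf : Continuous f)
    (hanti : AntitoneOn f (Ici 0)) {a b s : ℝ} (ha : 0 ≤ a) (hs : s ∈ Icc a b) :
    |(∫ t in a..b, t ^ (p - 1) * f t) - (b ^ p - a ^ p) / p * f s| ≤
      (b ^ p - a ^ p) / p * (f a - f b) := by
  have hab : a ≤ b := hs.1.trans hs.2
  have hW : 0 ≤ (b ^ p - a ^ p) / p :=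
    div_nonneg (sub_nonneg.2 (Real.rpow_le_rpow ha hab hp.le)) hp.le
  have hfs : f b ≤ f s ∧ f s ≤ f a :=
    ⟨hanti (mem_Ici.2 (ha.trans hs.1)) (mem_Ici.2 (ha.trans hab)) hs.2,
      hanti (mem_Ici.2 ha) (mem_Ici.2 (ha.trans hs.1)) hs.1⟩
  have hc : ∀ c, ∫ t in a..b, t ^ (p - 1) * c = (b ^ p - a ^ p) / p * c := fun c => by
    rw [intervalIntegral.integral_mul_const, integral_rpow_sub_one hp]
  have h1 : (b ^ p - a ^ p) / p * f b ≤ ∫ t in a..b, t ^ (p - 1) * f t := by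
    rw [← hc]
    refine intervalIntegral.integral_mono_on hab
      (intervalIntegrable_rpow_mul hp continuous_const _ _)
      (intervalIntegrable_rpow_mul hp hf _ _) fun t ht => ?_
    have ht0 : 0 ≤ t := ha.trans ht.1
    exact mul_le_mul_of_nonneg_left (hanti (mem_Ici.2 ht0) (mem_Ici.2 (ha.trans hab)) ht.2)
      (by positivity)
  have h2 : ∫ t in a..b, t ^ (p - 1) * f t ≤ (b ^ p - a ^ p) / p * f a := by
    rw [← hc]
    refine intervalIntegral.integral_mono_on hab
      (intervalIntegrable_rpow_mul hp hf _ _)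
      (intervalIntegrable_rpow_mul hp continuous_const _ _) fun t ht => ?_
    have ht0 : 0 ≤ t := ha.trans ht.1
    exact mul_le_mul_of_nonneg_left (hanti (mem_Ici.2 ha) (mem_Ici.2 ht0) ht.1)
      (by positivity)
  have h3 := mul_le_mul_of_nonneg_left hfs.1 hW
  have h4 := mul_le_mul_of_nonneg_left hfs.2 hW
  rw [abs_le, mul_sub]
  constructor <;> linarith

theorem gradedMesh_inv_rpow {p : ℝ} (hp : 0 < p) (N i : ℕ) :
    gradedMesh p⁻¹ N i ^ p = (i : ℝ) / N := by
  rw [gradedMesh, ← Real.rpow_mul (by positivity), inv_mul_cancel₀ hp.ne', Real.rpow_one]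

/-- On the graded mesh all cells have the same mass `1 / (pN)` for the weight `t^{p-1}`, so for an
antitone integrand the cell errors telescope. -/
theorem abs_rectangle_error_le {p : ℝ} (hp : 0 < p) {f : ℝ → ℝ} (hf : Continuous f)
    (hanti : AntitoneOn f (Ici 0)) (hf1 : 0 ≤ f 1) {N : ℕ} (hN : 1 ≤ N) {s : ℕ → ℝ}
    (hs : IsSampling p⁻¹ N s) :
    |(∫ t in (0 : ℝ)..1, t ^ (p - 1) * f t) - (p * N)⁻¹ * ∑ i ∈ Finset.range N, f (s i)| ≤
      (p * N)⁻¹ * f 0 := by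
  have hN0 : (0 : ℝ) < N := by exact_mod_cast hN
  set a := gradedMesh p⁻¹ N with ha
  have ha0 : a 0 = 0 := by simp [ha, gradedMesh, Real.zero_rpow (inv_ne_zero hp.ne')]
  have haN : a N = 1 := by simp [ha, gradedMesh, div_self hN0.ne']
  have hpos : ∀ i, 0 ≤ a i := fun i => Real.rpow_nonneg (by positivity) _
  have hmass : ∀ i, (a (i + 1) ^ p - a i ^ p) / p = (p * N)⁻¹ := fun i => by
    rw [ha, gradedMesh_inv_rpow hp, gradedMesh_inv_rpow hp]
    push_cast
    field_simp
    ring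
  have hsum := intervalIntegral.sum_integral_adjacent_intervals (n := N) (a := a)
    (fun i _ => intervalIntegrable_rpow_mul hp hf (a i) (a (i + 1)))
  rw [ha0, haN] at hsum
  rw [← hsum, Finset.mul_sum, ← Finset.sum_sub_distrib]
  calc _ ≤ ∑ i ∈ Finset.range N, (p * N)⁻¹ * (f (a i) - f (a (i + 1))) := by
        refine (Finset.abs_sum_le_sum_abs _ _).trans (Finset.sum_le_sum fun i hi => ?_)
        have := abs_cell_error_le hp hf hanti (hpos i)
          (Ioc_subset_Icc_self (hs i (Finset.mem_range.1 hi)))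
        rwa [hmass] at this
    _ = (p * N)⁻¹ * (f 0 - f 1) := by
        rw [← Finset.mul_sum, Finset.sum_range_sub', ha0, haN]
    _ ≤ _ := mul_le_mul_of_nonneg_left (by linarith) (by positivity)

/-- The scalar rectangle rule error; the estimate obtained is `BR` without its terms in `π ρ`. -/
theorem abs_rpow_sub_rectangle_le {β m μ : ℝ} (hβ : 0 < β) (hβ1 : β < 1) (hm : 0 < m)
    (hmμ : m ≤ μ) {N : ℕ} (hN : 1 ≤ N) {s₁ s₂ : ℕ → ℝ} (hs₁ : IsSampling (2 * β)⁻¹ N s₁)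
    (hs₂ : IsSampling (2 - 2 * β)⁻¹ N s₂) :
    |m ^ β - 1 / (2 * N * Cbeta β) * ∑ i ∈ Finset.range N,
      (β⁻¹ * (1 + s₁ i ^ 2 * m⁻¹)⁻¹ + (1 - β)⁻¹ * (s₂ i ^ 2 + m⁻¹)⁻¹)| ≤ BR β μ N := by
  have hN0 : (0 : ℝ) < N := by exact_mod_cast hN
  have hC := Cbeta_pos hβ hβ1
  have hb : 0 < 1 - β := by linarith
  have hm' := inv_pos.2 hm
  have hρ : ∀ θ, 0 ≤ rho θ := fun θ => by
    unfold rho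
    split_ifs with h
    · exact sub_nonneg.2 (Real.one_le_rpow one_le_two (by linarith))
    · exact zero_le_one
  have h1 := abs_rectangle_error_le (by linarith) (continuous_inv_one_add_sq_mul hm')
    (antitoneOn_inv_one_add_sq_mul hm') (by positivity) hN hs₁
  have h2 := abs_rectangle_error_le (by linarith) (continuous_inv_sq_add hm')
    (antitoneOn_inv_sq_add hm') (by positivity) hN hs₂
  have h3 := rpow_mul_Cbeta_eq_add hβ hβ1 hm
  rw [Finset.sum_add_distrib, ← Finset.mul_sum, ← Finset.mul_sum]
  set I₁ := ∫ t in (0 : ℝ)..1, t ^ (2 * β - 1) * (1 + t ^ 2 * m⁻¹)⁻¹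
  set I₂ := ∫ t in (0 : ℝ)..1, t ^ (2 - 2 * β - 1) * (t ^ 2 + m⁻¹)⁻¹
  set S₁ := ∑ i ∈ Finset.range N, (1 + s₁ i ^ 2 * m⁻¹)⁻¹
  set S₂ := ∑ i ∈ Finset.range N, (s₂ i ^ 2 + m⁻¹)⁻¹
  have h4 : m ^ β - 1 / (2 * N * Cbeta β) * (β⁻¹ * S₁ + (1 - β)⁻¹ * S₂) =
      (Cbeta β)⁻¹ * ((I₁ - (2 * β * N)⁻¹ * S₁) + (I₂ - ((2 - 2 * β) * N)⁻¹ * S₂)) := by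
    have h5 : m ^ β = (Cbeta β)⁻¹ * (I₁ + I₂) := by rw [← h3]; field_simp
    have h6 : (2 - 2 * β) = 2 * (1 - β) := by ring
    rw [h5, h6]
    field_simp
    ring
  have h5 : BR β μ N = (Cbeta β)⁻¹ * ((2 * β * N)⁻¹ + ((2 - 2 * β) * N)⁻¹ * μ +
      ((2 * β * N)⁻¹ * (1 + rho (2 * β)⁻¹ * Real.pi) +
        ((2 - 2 * β) * N)⁻¹ * (μ * (1 + rho (2 - 2 * β)⁻¹ * Real.pi)))) := by
    have h6 : (2 - 2 * β) = 2 * (1 - β) := by ring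
    rw [BR]
    generalize rho (2 * β)⁻¹ = r₁
    generalize rho (2 - 2 * β)⁻¹ = r₂
    rw [h6]
    field_simp
    ring
  rw [h4, h5, abs_mul, abs_of_pos (inv_pos.2 hC)]
  have h6 : 0 ≤ (2 * β * N)⁻¹ * (1 + rho (2 * β)⁻¹ * Real.pi) :=
    mul_nonneg (by positivity) (add_nonneg zero_le_one (mul_nonneg (hρ _) Real.pi_pos.le))
  have hb2 : 0 < 2 - 2 * β := by linarith
  have h7 : 0 ≤ ((2 - 2 * β) * N)⁻¹ * (μ * (1 + rho (2 - 2 * β)⁻¹ * Real.pi)) :=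
    mul_nonneg (by positivity) (mul_nonneg (hm.le.trans hmμ)
      (add_nonneg zero_le_one (mul_nonneg (hρ _) Real.pi_pos.le)))
  have h8 : ((2 - 2 * β) * N)⁻¹ * (0 ^ 2 + m⁻¹)⁻¹ ≤ ((2 - 2 * β) * N)⁻¹ * μ := by
    refine mul_le_mul_of_nonneg_left ?_ (by positivity)
    simpa using hmμ
  have h9 : (2 * β * N)⁻¹ * (1 + 0 ^ 2 * m⁻¹)⁻¹ = (2 * β * N)⁻¹ := by simp
  refine mul_le_mul_of_nonneg_left ((abs_add_le _ _).trans ?_) (inv_pos.2 hC).le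
  linarith

end Rectangle

/-! ### Existence of Gaussian quadrature rules -/

section GaussExistence

open Polynomial Set

/-- A linear functional on the real polynomials that is positive on the nonzero polynomials
nonnegative on `[a, b]`. -/
def IsPositiveFunctional (a b : ℝ) (J : ℝ[X] →ₗ[ℝ] ℝ) : Prop :=
  ∀ p : ℝ[X], p ≠ 0 → (∀ x ∈ Icc a b, 0 ≤ p.eval x) → 0 < J p

/-- `p` is an orthogonal polynomial of degree `r` for the functional `J`. -/
def IsOrthogonalPoly (J : ℝ[X] →ₗ[ℝ] ℝ) (r : ℕ) (p : ℝ[X]) : Prop :=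
  p ≠ 0 ∧ p.natDegree = r ∧ ∀ q : ℝ[X], q.degree < r → J (p * q) = 0

variable {a b : ℝ} {J : ℝ[X] →ₗ[ℝ] ℝ} {r : ℕ}

theorem exists_isOrthogonalPoly (hJ : IsPositiveFunctional a b J) (r : ℕ) :
    ∃ p, IsOrthogonalPoly J r p := by
  -- a dimension count: `r` conditions on the `r + 1` coefficients
  let Φ : degreeLT ℝ (r + 1) →ₗ[ℝ] (Fin r → ℝ) :=
    LinearMap.pi fun k => J ∘ₗ LinearMap.mulRight ℝ (X ^ (k : ℕ)) ∘ₗ (degreeLT ℝ (r + 1)).subtype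
  have : FiniteDimensional ℝ (degreeLT ℝ (r + 1)) :=
    (degreeLTEquiv ℝ (r + 1)).symm.finiteDimensional
  have hfr : Module.finrank ℝ (Fin r → ℝ) < Module.finrank ℝ (degreeLT ℝ (r + 1)) := by
    rw [(degreeLTEquiv ℝ (r + 1)).finrank_eq]; simp
  obtain ⟨⟨p, hp⟩, hpk, hp0⟩ :=
    (Submodule.ne_bot_iff _).1 (LinearMap.ker_ne_bot_of_finrank_lt (f := Φ) hfr)
  have hp0' : p ≠ 0 := fun h => hp0 (Subtype.ext h)
  have horth : ∀ q : ℝ[X], q.degree < r → J (p * q) = 0 := by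
    intro q hq
    rcases eq_or_ne q 0 with rfl | hq0
    · simp
    rw [as_sum_range_C_mul_X_pow q, Finset.mul_sum, map_sum]
    refine Finset.sum_eq_zero fun k hk => ?_
    have hkr : k < r := by
      have := (natDegree_lt_iff_degree_lt hq0).2 hq
      have := Finset.mem_range.1 hk
      omega
    have h1 := congrFun hpk ⟨k, hkr⟩
    have h2 : J (p * X ^ k) = 0 := h1
    rw [mul_left_comm, ← smul_eq_C_mul, map_smul, h2, smul_zero]
  refine ⟨p, hp0', le_antisymm ?_ ?_, horth⟩
  · have h1 := mem_degreeLT.1 hp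
    have := (natDegree_lt_iff_degree_lt hp0').2 h1
    omega
  · by_contra! h
    have h1 := horth p ((natDegree_lt_iff_degree_lt hp0').1 h)
    refine (hJ (p * p) (mul_ne_zero hp0' hp0') fun x _ => ?_).ne' h1
    rw [eval_mul]
    exact mul_self_nonneg _

/-- An orthogonal polynomial has no nonconstant factor `s` that is nonnegative on `[a, b]`: for
`p = s q` the polynomial `p q = s q²` would have a positive integral. -/
theorem IsOrthogonalPoly.not_dvd_of_nonneg (hJ : IsPositiveFunctional a b J) {p : ℝ[X]}
    (hp : IsOrthogonalPoly J r p) {s : ℝ[X]} (hs : ∀ x ∈ Icc a b, 0 ≤ s.eval x)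
    (hdeg : 0 < s.natDegree) : ¬ s ∣ p := by
  rintro ⟨q, rfl⟩
  obtain ⟨hp0, hpr, horth⟩ := hp
  have hs0 := left_ne_zero_of_mul hp0
  have hq0 := right_ne_zero_of_mul hp0
  rw [natDegree_mul hs0 hq0] at hpr
  have h1 := horth q ((natDegree_lt_iff_degree_lt hq0).1 (by omega))
  refine (hJ _ (mul_ne_zero hp0 hq0) fun x hx => ?_).ne' h1
  rw [eval_mul, eval_mul, mul_assoc]
  exact mul_nonneg (hs x hx) (mul_self_nonneg _)

theorem IsOrthogonalPoly.root_mem (hJ : IsPositiveFunctional a b J) {p : ℝ[X]}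
    (hp : IsOrthogonalPoly J r p) {x : ℝ} (hx : p.IsRoot x) : x ∈ Icc a b := by
  have hdvd := dvd_iff_isRoot.2 hx
  constructor <;> by_contra! h
  · refine hp.not_dvd_of_nonneg hJ (s := X - C x) (fun y hy => ?_) (by simp) hdvd
    simp only [eval_sub, eval_X, eval_C]
    linarith [hy.1]
  · refine hp.not_dvd_of_nonneg hJ (s := -(X - C x)) (fun y hy => ?_)
      (by rw [natDegree_neg]; simp) (neg_dvd.2 hdvd)
    simp only [eval_neg, eval_sub, eval_X, eval_C]
    linarith [hy.2]

theorem IsOrthogonalPoly.nodup_roots (hJ : IsPositiveFunctional a b J) {p : ℝ[X]}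
    (hp : IsOrthogonalPoly J r p) : p.roots.Nodup := by
  rw [Multiset.nodup_iff_count_le_one]
  intro x
  rw [count_roots]
  by_contra! h
  refine hp.not_dvd_of_nonneg hJ (s := (X - C x) ^ 2) (fun y _ => ?_) (by simp)
    ((le_rootMultiplicity_iff hp.1).1 h)
  rw [eval_pow]
  exact sq_nonneg _

/-- All complex roots are real: a nonreal root contributes a positive quadratic factor. -/
theorem IsOrthogonalPoly.card_roots (hJ : IsPositiveFunctional a b J) {p : ℝ[X]}
    (hp : IsOrthogonalPoly J r p) : Multiset.card p.roots = r := by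
  obtain ⟨q, hq, hcard, hroots⟩ := exists_prod_multiset_X_sub_C_mul p
  have hq0 : q ≠ 0 := by
    rintro rfl
    exact hp.1 (by rw [← hq, mul_zero])
  rw [hp.2.1] at hcard
  suffices q.natDegree = 0 by omega
  by_contra hne
  obtain ⟨z, hz⟩ := IsAlgClosed.exists_aeval_eq_zero ℂ q
    (fun h => hne (natDegree_eq_of_degree_eq_some h))
  have him : z.im ≠ 0 := by
    intro h
    have hzr : z = (algebraMap ℝ ℂ) z.re := Complex.ext (by simp) (by simp [h])
    rw [hzr, aeval_algebraMap_apply, map_eq_zero_iff _ (algebraMap ℝ ℂ).injective] at hz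
    have : z.re ∈ q.roots := (mem_roots hq0).2 (by simpa [IsRoot, aeval_def] using hz)
    simp [hroots] at this
  have hdvd := (quadratic_dvd_of_aeval_eq_zero_im_ne_zero q hz him).trans (Dvd.intro_left _ hq)
  refine hp.not_dvd_of_nonneg hJ (fun x _ => ?_) ?_ hdvd
  · simp only [eval_add, eval_sub, eval_pow, eval_X, eval_mul, eval_C]
    rw [← Complex.normSq_eq_norm_sq, Complex.normSq_apply]
    nlinarith [sq_nonneg (x - z.re), mul_self_nonneg z.im]
  · have : (X ^ 2 - C (2 * z.re) * X + C (‖z‖ ^ 2) : ℝ[X]).natDegree = 2 := by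
      compute_degree!
    omega

/-- The Gaussian rule: the nodes are the roots of the orthogonal polynomial of degree `r`, the
weights are the integrals of the Lagrange basis polynomials. -/
theorem exists_gauss_nodes_weights (hJ : IsPositiveFunctional a b J) (r : ℕ) :
    ∃ t A : Fin r → ℝ, StrictMono t ∧ (∀ k, t k ∈ Icc a b) ∧
      ∀ f : ℝ[X], f.natDegree < 2 * r → ∑ k, A k * f.eval (t k) = J f := by
  classical
  obtain ⟨p, hp⟩ := exists_isOrthogonalPoly hJ r
  have hcard : p.roots.toFinset.card = r := by
    rw [Multiset.toFinset_card_of_nodup (hp.nodup_roots hJ), hp.card_roots hJ]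
  let t : Fin r → ℝ := p.roots.toFinset.orderEmbOfFin hcard
  have ht : StrictMono t := (p.roots.toFinset.orderEmbOfFin hcard).strictMono
  have hroot : ∀ k, p.IsRoot (t k) := fun k =>
    isRoot_of_mem_roots (Multiset.mem_toFinset.1 (Finset.orderEmbOfFin_mem _ hcard k))
  refine ⟨t, fun k => J (Lagrange.basis Finset.univ t k), ht, fun k => hp.root_mem hJ (hroot k),
    fun f hf => ?_⟩
  have hp0 := hp.1
  have hmod : (f % p).degree < r := by
    have := EuclideanDomain.mod_lt f hp0
    change (f % p).degree < p.degree at this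
    rwa [degree_eq_natDegree hp0, hp.2.1] at this
  have hdiv : (f / p).degree < r := by
    rcases eq_or_ne (f / p) 0 with h0 | h0
    · rw [h0, degree_zero]; exact WithBot.bot_lt_coe r
    have hle : p.degree ≤ f.degree := by
      by_contra! h
      exact h0 ((Polynomial.div_eq_zero_iff hp0).2 h)
    have h1 := natDegree_eq_of_degree_eq ((degree_mul (p := p) (q := f / p)).trans
      (degree_add_div hp0 hle))
    rw [natDegree_mul hp0 h0, hp.2.1] at h1
    rw [← natDegree_lt_iff_degree_lt h0]
    omega
  have hf : f = p * (f / p) + f % p := (EuclideanDomain.div_add_mod f p).symm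
  have hinterp : f % p = ∑ k, C (f.eval (t k)) * Lagrange.basis Finset.univ t k := by
    rw [Lagrange.eq_interpolate_of_eval_eq (f := f % p) (s := Finset.univ) (v := t)
      (r := fun k => f.eval (t k)) ht.injective.injOn (by simpa using hmod) ?_]
    · rfl
    · intro k _
      conv_rhs => rw [hf]
      simp [(hroot k).eq_zero]
  conv_rhs => rw [hf, map_add, hp.2.2 _ hdiv, zero_add, hinterp, map_sum]
  refine Finset.sum_congr rfl fun k _ => ?_
  rw [← smul_eq_C_mul, map_smul, smul_eq_mul, mul_comm]

theorem intervalIntegrable_mul_eval {w : ℝ → ℝ} (hab : a ≤ b) (hw : ContinuousOn w (Icc a b))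
    (p : ℝ[X]) : IntervalIntegrable (fun x => w x * p.eval x) volume a b :=
  ContinuousOn.intervalIntegrable_of_Icc hab (hw.mul p.continuous.continuousOn)

theorem exists_isGaussRule {w : ℝ → ℝ} (hab : a < b) (hw : ContinuousOn w (Icc a b))
    (hpos : ∀ x ∈ Icc a b, 0 < w x) (r : ℕ) : ∃ t A, IsGaussRule w a b r t A := by
  let J : ℝ[X] →ₗ[ℝ] ℝ :=
    { toFun := fun p => ∫ x in a..b, w x * p.eval x
      map_add' := fun p q => by
        simp only [eval_add, mul_add]
        exact intervalIntegral.integral_add (intervalIntegrable_mul_eval hab.le hw p)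
          (intervalIntegrable_mul_eval hab.le hw q)
      map_smul' := fun c p => by
        simp only [eval_smul, smul_eq_mul, RingHom.id_apply]
        rw [← intervalIntegral.integral_const_mul]
        congr 1 with x
        ring }
  have hJ : IsPositiveFunctional a b J := by
    intro p hp0 hp
    obtain ⟨c, hc, hpc⟩ : ∃ c ∈ Icc a b, p.eval c ≠ 0 := by
      by_contra! h
      exact hp0 (p.eq_zero_of_infinite_isRoot ((Icc_infinite hab).mono h))
    exact intervalIntegral.integral_pos hab (hw.mul p.continuous.continuousOn)
      (fun x hx => mul_nonneg (hpos x (Ioc_subset_Icc_self hx)).le (hp x (Ioc_subset_Icc_self hx)))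
      ⟨c, hc, mul_pos (hpos c hc) (lt_of_le_of_ne (hp c hc) hpc.symm)⟩
  exact exists_gauss_nodes_weights hJ r

end GaussExistence

/-! ### The error of a Gaussian rule -/

section GaussError

open Polynomial Set

variable {w : ℝ → ℝ} {a b : ℝ} {r : ℕ} {t A : Fin r → ℝ}

/-- The rule is exact for the square of the `k`-th Lagrange basis polynomial of the nodes, whose
quadrature sum is the weight `A k`. -/
theorem IsGaussRule.weight_nonneg (h : IsGaussRule w a b r t A) (hab : a ≤ b)
    (hw : ∀ x ∈ Icc a b, 0 ≤ w x) (k : Fin r) : 0 ≤ A k := by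
  classical
  have hinj : Set.InjOn t (Finset.univ : Finset (Fin r)) := h.1.injective.injOn
  have hr : 0 < r := k.pos
  have hdeg : (Lagrange.basis Finset.univ t k ^ 2).natDegree < 2 * r := by
    rw [natDegree_pow, Lagrange.natDegree_basis hinj (Finset.mem_univ k), Finset.card_univ,
      Fintype.card_fin]
    omega
  have h1 := h.2.2 _ hdeg
  rw [Finset.sum_eq_single k] at h1
  · rw [eval_pow, Lagrange.eval_basis_self hinj (Finset.mem_univ k), one_pow, mul_one] at h1
    rw [h1]
    refine intervalIntegral.integral_nonneg hab fun x hx => mul_nonneg (hw x hx) ?_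
    rw [eval_pow]
    exact sq_nonneg _
  · intro j _ hj
    rw [eval_pow, Lagrange.eval_basis_of_ne hj.symm (Finset.mem_univ j)]
    simp
  · simp

/-- A rule with nonnegative weights is off by at most twice the error of the best uniform
approximation of the integrand by polynomials of degree at most `2r - 1`. -/
theorem IsGaussRule.abs_error_le (h : IsGaussRule w a b r t A) (hr : 1 ≤ r) (hab : a ≤ b)
    (hwc : ContinuousOn w (Icc a b)) (hw : ∀ x ∈ Icc a b, 0 ≤ w x) {f : ℝ → ℝ}
    (hf : Continuous f) {p : ℝ[X]} (hp : p.natDegree < 2 * r) {ε : ℝ}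
    (hε : ∀ x ∈ Icc a b, |f x - p.eval x| ≤ ε) :
    |(∫ x in a..b, w x * f x) - ∑ k, A k * f (t k)| ≤ 2 * ε * ∫ x in a..b, w x := by
  have hsum : ∑ k, A k = ∫ x in a..b, w x := by
    have := h.2.2 1 (by rw [natDegree_one]; omega)
    simpa using this
  have h1 : |(∫ x in a..b, w x * f x) - ∫ x in a..b, w x * p.eval x| ≤
      ε * ∫ x in a..b, w x := by
    have hpi := intervalIntegrable_mul_eval hab hwc p
    have hfi : IntervalIntegrable (fun x => w x * f x) volume a b :=
      ContinuousOn.intervalIntegrable_of_Icc hab (hwc.mul hf.continuousOn)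
    rw [← intervalIntegral.integral_sub hfi hpi, ← intervalIntegral.integral_const_mul]
    refine (intervalIntegral.abs_integral_le_integral_abs hab).trans
      (intervalIntegral.integral_mono_on hab (hfi.sub hpi).abs
        ((ContinuousOn.intervalIntegrable_of_Icc hab hwc).const_mul ε) fun x hx => ?_)
    rw [← mul_sub, abs_mul, abs_of_nonneg (hw x hx), mul_comm]
    exact mul_le_mul_of_nonneg_right (hε x hx) (hw x hx)
  have h2 : |(∑ k, A k * p.eval (t k)) - ∑ k, A k * f (t k)| ≤ ε * ∫ x in a..b, w x := by
    rw [← Finset.sum_sub_distrib, ← hsum, Finset.mul_sum]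
    refine (Finset.abs_sum_le_sum_abs _ _).trans (Finset.sum_le_sum fun k _ => ?_)
    have hA := h.weight_nonneg hab hw k
    rw [← mul_sub, abs_mul, abs_of_nonneg hA, mul_comm, abs_sub_comm]
    exact mul_le_mul_of_nonneg_right (hε _ (h.2.1 k)) hA
  rw [h.2.2 p hp] at h2
  refine (abs_sub_le _ _ _).trans ((add_le_add h1 h2).trans_eq ?_)
  ring

/-- Expansion of `a² / (x² + a²) = a Im (x - ia)⁻¹` about `c` by the geometric series: since
`|c - ia| ≥ c`, its convergence is as good as that of `(1 + (x - c) / c)⁻¹`, uniformly in `a`. -/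
theorem exists_polynomial_approx {a c : ℝ} (ha : 0 < a) (hc : 0 < c) {n : ℕ} (hn : 1 ≤ n) :
    ∃ p : ℝ[X], p.natDegree < n ∧
      ∀ x, |a ^ 2 / (x ^ 2 + a ^ 2) - p.eval x| ≤ (|x - c| / c) ^ n := by
  let z : ℝ → ℂ := fun x => x - a * Complex.I
  have hz_im : ∀ x, (z x).im = -a := fun x => by simp [z]
  have hz_re : ∀ x, (z x).re = x := fun x => by simp [z]
  have hz0 : ∀ x, z x ≠ 0 := fun x h => by
    have := hz_im x
    rw [h, Complex.zero_im] at this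
    linarith
  have hza : ∀ x, a ≤ ‖z x‖ := fun x => by
    have := Complex.abs_im_le_norm (z x)
    rwa [hz_im, abs_neg, abs_of_pos ha] at this
  have hzc : c ≤ ‖z c‖ := by
    have := Complex.abs_re_le_norm (z c)
    rwa [hz_re, abs_of_pos hc] at this
  have hgeom : ∀ (x : ℝ) (m : ℕ),
      (z x)⁻¹ - ∑ k ∈ Finset.range m, ((c - x : ℝ) : ℂ) ^ k / z c ^ (k + 1) =
      (((c - x : ℝ) : ℂ) / z c) ^ m * (z x)⁻¹ := by
    intro x m
    induction m with
    | zero => simp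
    | succ m ih =>
      rw [Finset.sum_range_succ, ← sub_sub, ih]
      have h1 : ((c - x : ℝ) : ℂ) = z c - z x := by simp [z]
      have h2 := hz0 x
      have h3 := hz0 c
      rw [h1, div_pow, div_pow]
      field_simp
      ring
  refine ⟨∑ k ∈ Finset.range n, C (a * ((-1) ^ k / z c ^ (k + 1)).im) * (X - C c) ^ k, ?_, ?_⟩
  · refine lt_of_le_of_lt (natDegree_sum_le_of_forall_le (n := n - 1) _ _ fun k hk => ?_)
      (by omega)
    refine (natDegree_C_mul_le _ _).trans ?_
    rw [natDegree_pow, natDegree_X_sub_C]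
    have := Finset.mem_range.1 hk
    omega
  · intro x
    have h1 : a ^ 2 / (x ^ 2 + a ^ 2) = a * ((z x)⁻¹).im := by
      rw [Complex.inv_im, hz_im, Complex.normSq_apply, hz_re, hz_im]
      ring
    have h2 : eval x (∑ k ∈ Finset.range n, C (a * ((-1) ^ k / z c ^ (k + 1)).im) * (X - C c) ^ k) =
        a * (∑ k ∈ Finset.range n, ((c - x : ℝ) : ℂ) ^ k / z c ^ (k + 1)).im := by
      rw [eval_finsetSum, Complex.im_sum, Finset.mul_sum]
      refine Finset.sum_congr rfl fun k _ => ?_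
      have h3 : ((c - x : ℝ) : ℂ) ^ k / z c ^ (k + 1) =
          (((x - c) ^ k : ℝ) : ℂ) * ((-1) ^ k / z c ^ (k + 1)) := by
        have : ((c - x : ℝ) : ℂ) = -1 * ((x - c : ℝ) : ℂ) := by push_cast; ring
        rw [this, mul_pow]
        push_cast
        ring
      rw [h3, Complex.im_ofReal_mul]
      simp only [eval_mul, eval_C, eval_pow, eval_sub, eval_X]
      ring
    rw [h1, h2, ← mul_sub, ← Complex.sub_im, hgeom, abs_mul, abs_of_pos ha]
    calc a * |((((c - x : ℝ) : ℂ) / z c) ^ n * (z x)⁻¹).im|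
        ≤ a * ‖(((c - x : ℝ) : ℂ) / z c) ^ n * (z x)⁻¹‖ := by
          gcongr; exact Complex.abs_im_le_norm _
      _ = (|x - c| / ‖z c‖) ^ n * (a / ‖z x‖) := by
          rw [norm_mul, norm_pow, norm_div, norm_inv, Complex.norm_real, Real.norm_eq_abs,
            abs_sub_comm]
          ring
      _ ≤ (|x - c| / c) ^ n * 1 := by
          gcongr
          exact div_le_one_of_le₀ (hza x) (norm_nonneg _)
      _ = _ := mul_one _

end GaussError

/-! ### The Gaussian rule on the dyadic partition -/

section Dyadic

open Set

theorem dyadicPoint_pos (N i j : ℕ) : 0 < dyadicPoint N i j := by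
  unfold dyadicPoint; positivity

theorem dyadicPoint_zero_right (N i : ℕ) : dyadicPoint N i 0 = (2 ^ i)⁻¹ := by
  simp [dyadicPoint]

theorem dyadicPoint_succ_self {N : ℕ} (hN : 1 ≤ N) (i : ℕ) :
    dyadicPoint N (i + 1) N = dyadicPoint N i 0 := by
  have : (N : ℝ) ≠ 0 := by exact_mod_cast (Nat.one_le_iff_ne_zero.1 hN)
  rw [dyadicPoint_zero_right, dyadicPoint, div_self this, pow_succ, mul_inv]
  ring

theorem dyadicPoint_sub {N j : ℕ} (i : ℕ) (hj : 1 ≤ j) :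
    dyadicPoint N i j - dyadicPoint N i (j - 1) = (2 ^ i)⁻¹ * (N : ℝ)⁻¹ := by
  unfold dyadicPoint
  rw [Nat.cast_sub hj]
  push_cast
  ring

theorem dyadicPoint_pred_lt {N i j : ℕ} (hN : 1 ≤ N) (hj : 1 ≤ j) :
    dyadicPoint N i (j - 1) < dyadicPoint N i j := by
  have hN0 : (0 : ℝ) < N := by exact_mod_cast hN
  rw [← sub_pos, dyadicPoint_sub i hj]
  positivity

theorem inv_two_pow_le_dyadicPoint (N i j : ℕ) : (2 ^ i)⁻¹ ≤ dyadicPoint N i j :=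
  le_mul_of_one_le_right (by positivity) (le_add_of_nonneg_right (by positivity))

theorem sum_integral_dyadic {g : ℝ → ℝ} (hg : ∀ a b, IntervalIntegrable g volume a b) {N : ℕ}
    (hN : 1 ≤ N) (M : ℕ) :
    ∑ i ∈ Finset.Icc 1 M, ∑ j ∈ Finset.Icc 1 N,
      ∫ x in dyadicPoint N i (j - 1)..dyadicPoint N i j, g x = ∫ x in (2 ^ M)⁻¹..1, g x := by
  have hinner : ∀ i n, ∑ j ∈ Finset.Icc 1 n,
      ∫ x in dyadicPoint N i (j - 1)..dyadicPoint N i j, g x =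
        ∫ x in dyadicPoint N i 0..dyadicPoint N i n, g x := by
    intro i n
    induction n with
    | zero => simp
    | succ n ih =>
      rw [Finset.sum_Icc_succ_top (by omega), ih, Nat.add_sub_cancel,
        intervalIntegral.integral_add_adjacent_intervals (hg _ _) (hg _ _)]
  simp only [hinner]
  induction M with
  | zero => simp
  | succ M ih =>
    rw [Finset.sum_Icc_succ_top (by omega), ih, dyadicPoint_succ_self hN, dyadicPoint_zero_right,
      dyadicPoint_zero_right, add_comm,
      intervalIntegral.integral_add_adjacent_intervals (hg _ _) (hg _ _)]

theorem exists_isDyadicGauss (s : ℝ) {N : ℕ} (hN : 1 ≤ N) (M r : ℕ) :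
    ∃ t A, IsDyadicGauss (fun x => x ^ s) M N r t A := by
  have h : ∀ i j : ℕ, ∃ tA : (Fin r → ℝ) × (Fin r → ℝ), 1 ≤ j →
      IsGaussRule (fun x => x ^ s) (dyadicPoint N i (j - 1)) (dyadicPoint N i j) r tA.1 tA.2 := by
    intro i j
    by_cases hj : 1 ≤ j
    · have hpos : ∀ x ∈ Icc (dyadicPoint N i (j - 1)) (dyadicPoint N i j), 0 < x := fun x hx =>
        (dyadicPoint_pos N i (j - 1)).trans_le hx.1
      obtain ⟨t, A, hA⟩ := exists_isGaussRule (w := fun x => x ^ s) (dyadicPoint_pred_lt hN hj)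
        (fun x hx => (Real.continuousAt_rpow_const x s (Or.inl (hpos x hx).ne')).continuousWithinAt)
        (fun x hx => Real.rpow_pos_of_pos (hpos x hx) s) r
      exact ⟨(t, A), fun _ => hA⟩
    · exact ⟨(0, 0), fun h => absurd h hj⟩
  choose tA htA using h
  exact ⟨fun i j => (tA i j).1, fun i j => (tA i j).2, fun i _ j hj =>
    htA i j (Finset.mem_Icc.1 hj).1⟩

theorem two_pow_inv_rpow_le {p : ℝ} {r N M : ℕ} (hN : 1 ≤ N)
    (hM : 2 * r * Real.logb 2 N ≤ p * M) : ((2 ^ M)⁻¹ : ℝ) ^ p ≤ ((N : ℝ) ^ (2 * r))⁻¹ := by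
  have hN0 : (0 : ℝ) < N := by exact_mod_cast hN
  have h1 : ((2 ^ M)⁻¹ : ℝ) ^ p = 2 ^ (-(p * M)) := by
    rw [← Real.rpow_natCast, ← Real.rpow_neg zero_le_two, ← Real.rpow_mul zero_le_two]
    congr 1; ring
  have h2 : ((N : ℝ) ^ (2 * r))⁻¹ = 2 ^ (-(2 * r * Real.logb 2 N)) := by
    rw [Real.rpow_neg zero_le_two, mul_comm (2 * (r : ℝ)), Real.rpow_mul zero_le_two,
      Real.rpow_logb zero_lt_two (by norm_num) hN0]
    congr 1
    exact_mod_cast (Real.rpow_natCast (N : ℝ) (2 * r)).symm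
  rw [h1, h2]
  exact Real.rpow_le_rpow_of_exponent_le one_le_two (neg_le_neg hM)

theorem two_mul_logb_le_dyadicLevels {β p : ℝ} (hβ : 0 < β) (hβ1 : β < 1)
    (hp : 2 * min β (1 - β) ≤ p) (r N : ℕ) :
    2 * r * Real.logb 2 N ≤ p * dyadicLevels β r N := by
  have hmin : 0 < min β (1 - β) := lt_min hβ (by linarith)
  have h1 : (r : ℝ) * Real.logb 2 N / min β (1 - β) ≤ dyadicLevels β r N := Nat.le_ceil _
  rw [div_le_iff₀ hmin] at h1
  have h2 := mul_le_mul_of_nonneg_right hp (Nat.cast_nonneg (α := ℝ) (dyadicLevels β r N))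
  linarith

/-- Error of the composite Gaussian rule for the weight `x^{p-1}` and the integrand
`a² / (x² + a²)`. On a dyadic interval the cell width is `1/N` times a lower bound of the distance
to the poles `± ia`, so each cell has relative error `2 N^{-2r}`; the remaining integral over
`(0, 2^{-M})` is of the same order. -/
theorem abs_dyadicGauss_error_le {p a : ℝ} (hp : 0 < p) (ha : 0 < a) {M N r : ℕ} (hN : 1 ≤ N)
    (hr : 1 ≤ r) (hM : 2 * r * Real.logb 2 N ≤ p * M) {t A : ℕ → ℕ → Fin r → ℝ}
    (h : IsDyadicGauss (fun x => x ^ (p - 1)) M N r t A) :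
    |(∫ x in (0 : ℝ)..1, x ^ (p - 1) * (a ^ 2 / (x ^ 2 + a ^ 2))) -
      ∑ i ∈ Finset.Icc 1 M, ∑ j ∈ Finset.Icc 1 N, ∑ k, A i j k * (a ^ 2 / (t i j k ^ 2 + a ^ 2))| ≤
      3 * ((N : ℝ) ^ (2 * r))⁻¹ / p := by
  set F : ℝ → ℝ := fun x => a ^ 2 / (x ^ 2 + a ^ 2) with hF
  have hFc : Continuous F := Continuous.div (by fun_prop) (by fun_prop) fun x => by positivity
  have hN0 : (0 : ℝ) < N := by exact_mod_cast hN
  have hM0 : (0 : ℝ) < (2 ^ M)⁻¹ := by positivity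
  have hM1 : ((2 ^ M)⁻¹ : ℝ) ≤ 1 := inv_le_one_of_one_le₀ (one_le_pow₀ one_le_two)
  have hint := intervalIntegrable_rpow_mul hp hFc
  have hintw : ∀ a b, IntervalIntegrable (fun x : ℝ => x ^ (p - 1)) volume a b := fun a b =>
    intervalIntegral.intervalIntegrable_rpow' (by linarith)
  have htail : |∫ x in (0 : ℝ)..(2 ^ M)⁻¹, x ^ (p - 1) * F x| ≤ ((N : ℝ) ^ (2 * r))⁻¹ / p := by
    rw [abs_of_nonneg (intervalIntegral.integral_nonneg hM0.le fun x hx => by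
      have := hx.1
      positivity)]
    calc ∫ x in (0 : ℝ)..(2 ^ M)⁻¹, x ^ (p - 1) * F x
        ≤ ∫ x in (0 : ℝ)..(2 ^ M)⁻¹, x ^ (p - 1) :=
          intervalIntegral.integral_mono_on hM0.le (hint _ _) (hintw _ _) fun x hx => by
            have := hx.1
            refine mul_le_of_le_one_right (by positivity) (div_le_one_of_le₀ ?_ (by positivity))
            exact le_add_of_nonneg_left (by positivity)
      _ = ((2 ^ M)⁻¹ : ℝ) ^ p / p := by
          rw [integral_rpow_sub_one hp, Real.zero_rpow hp.ne', sub_zero]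
      _ ≤ _ := by
          gcongr
          exact two_pow_inv_rpow_le hN hM
  have hcell : ∀ i ∈ Finset.Icc 1 M, ∀ j ∈ Finset.Icc 1 N,
      |(∫ x in dyadicPoint N i (j - 1)..dyadicPoint N i j, x ^ (p - 1) * F x) -
        ∑ k, A i j k * F (t i j k)| ≤ 2 * ((N : ℝ) ^ (2 * r))⁻¹ *
          ∫ x in dyadicPoint N i (j - 1)..dyadicPoint N i j, x ^ (p - 1) := by
    intro i hi j hj
    have hj1 := (Finset.mem_Icc.1 hj).1
    set c := dyadicPoint N i (j - 1) with hc
    have hc0 : 0 < c := dyadicPoint_pos _ _ _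
    obtain ⟨q, hq, hqF⟩ := exists_polynomial_approx ha hc0 (n := 2 * r) (by omega)
    have hpos : ∀ x ∈ Icc c (dyadicPoint N i j), 0 < x := fun x hx => hc0.trans_le hx.1
    refine (h i hi j hj).abs_error_le hr (dyadicPoint_pred_lt hN hj1).le
      (fun x hx => (Real.continuousAt_rpow_const x _ (Or.inl (hpos x hx).ne')).continuousWithinAt)
      (fun x hx => (Real.rpow_pos_of_pos (hpos x hx) _).le) hFc hq fun x hx => ?_
    refine (hqF x).trans ?_
    rw [← inv_pow]
    gcongr
    rw [abs_of_nonneg (sub_nonneg.2 hx.1), div_le_iff₀ hc0]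
    have h1 := dyadicPoint_sub (N := N) i hj1
    have h2 := mul_le_mul_of_nonneg_right (inv_two_pow_le_dyadicPoint N i (j - 1))
      (inv_pos.2 hN0).le
    rw [← h1, ← hc] at h2
    have h3 := hx.2
    linarith
  have hsplit : (∫ x in (0 : ℝ)..1, x ^ (p - 1) * F x) -
      ∑ i ∈ Finset.Icc 1 M, ∑ j ∈ Finset.Icc 1 N, ∑ k, A i j k * F (t i j k) =
      (∫ x in (0 : ℝ)..(2 ^ M)⁻¹, x ^ (p - 1) * F x) +
        ∑ i ∈ Finset.Icc 1 M, ∑ j ∈ Finset.Icc 1 N,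
          ((∫ x in dyadicPoint N i (j - 1)..dyadicPoint N i j, x ^ (p - 1) * F x) -
            ∑ k, A i j k * F (t i j k)) := by
    simp only [Finset.sum_sub_distrib]
    rw [sum_integral_dyadic hint hN,
      ← intervalIntegral.integral_add_adjacent_intervals (hint 0 (2 ^ M)⁻¹) (hint _ _)]
    ring
  have hsum : ∑ i ∈ Finset.Icc 1 M, ∑ j ∈ Finset.Icc 1 N,
      2 * ((N : ℝ) ^ (2 * r))⁻¹ *
        ∫ x in dyadicPoint N i (j - 1)..dyadicPoint N i j, x ^ (p - 1) ≤
      2 * ((N : ℝ) ^ (2 * r))⁻¹ / p := by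
    simp only [← Finset.mul_sum]
    rw [sum_integral_dyadic hintw hN, integral_rpow_sub_one hp, Real.one_rpow, mul_div_assoc']
    refine div_le_div_of_nonneg_right (mul_le_of_le_one_right ?_ (sub_le_self _ ?_)) hp.le <;>
      positivity
  rw [hsplit]
  calc _ ≤ ((N : ℝ) ^ (2 * r))⁻¹ / p + 2 * ((N : ℝ) ^ (2 * r))⁻¹ / p := by
        refine (abs_add_le _ _).trans (add_le_add htail (le_trans ?_ hsum))
        refine (Finset.abs_sum_le_sum_abs _ _).trans (Finset.sum_le_sum fun i hi => ?_)
        exact (Finset.abs_sum_le_sum_abs _ _).trans (Finset.sum_le_sum fun j hj => hcell i hi j hj)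
    _ = _ := by ring

theorem abs_rpow_sub_gauss_le {β m μ : ℝ} (hβ : 0 < β) (hβ1 : β < 1) (hm : 0 < m)
    (hmμ : m ≤ μ) {N r : ℕ} (hN : 1 ≤ N) (hr : 1 ≤ r) {t₁ A₁ t₂ A₂ : ℕ → ℕ → Fin r → ℝ}
    (h₁ : IsDyadicGauss (fun x => x ^ (2 * β - 1)) (dyadicLevels β r N) N r t₁ A₁)
    (h₂ : IsDyadicGauss (fun x => x ^ (1 - 2 * β)) (dyadicLevels β r N) N r t₂ A₂) :
    |m ^ β - 1 / Cbeta β * ∑ i ∈ Finset.Icc 1 (dyadicLevels β r N), ∑ j ∈ Finset.Icc 1 N,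
      ∑ k, (A₁ i j k * (1 + t₁ i j k ^ 2 * m⁻¹)⁻¹ + A₂ i j k * (t₂ i j k ^ 2 + m⁻¹)⁻¹)| ≤
      BG 3 β μ r N := by
  have hC := Cbeta_pos hβ hβ1
  have hb : 0 < 1 - β := by linarith
  have hM : ∀ p, 2 * min β (1 - β) ≤ p → 2 * r * Real.logb 2 N ≤ p * dyadicLevels β r N :=
    fun p hp => two_mul_logb_le_dyadicLevels hβ hβ1 hp r N
  have h₂' : IsDyadicGauss (fun x => x ^ (2 - 2 * β - 1)) (dyadicLevels β r N) N r t₂ A₂ := by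
    have : 2 - 2 * β - 1 = 1 - 2 * β := by ring
    rwa [this]
  have hs : √m ^ 2 = m := Real.sq_sqrt hm.le
  have hs' : (√m)⁻¹ ^ 2 = m⁻¹ := by rw [inv_pow, hs]
  have e₁ := abs_dyadicGauss_error_le (a := √m) (by linarith) (Real.sqrt_pos.2 hm) hN hr
    (hM (2 * β) (mul_le_mul_of_nonneg_left (min_le_left _ _) zero_le_two)) h₁
  have e₂ := abs_dyadicGauss_error_le (a := (√m)⁻¹) (by linarith)
    (inv_pos.2 (Real.sqrt_pos.2 hm)) hN hr
    (hM (2 - 2 * β) (by linarith [min_le_right β (1 - β)])) h₂'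
  have f₁ : ∀ x : ℝ, (1 + x ^ 2 * m⁻¹)⁻¹ = m / (x ^ 2 + m) := fun x => by
    field_simp
    ring
  have f₂ : ∀ x : ℝ, (x ^ 2 + m⁻¹)⁻¹ = m * (m⁻¹ / (x ^ 2 + m⁻¹)) := fun x => by
    field_simp
  rw [hs] at e₁
  rw [hs'] at e₂
  have h3 := rpow_mul_Cbeta_eq_add hβ hβ1 hm
  simp only [f₁, f₂, Finset.sum_add_distrib, mul_left_comm _ m, ← Finset.mul_sum,
    intervalIntegral.integral_const_mul] at h3 ⊢
  set I₁ := ∫ t in (0 : ℝ)..1, t ^ (2 * β - 1) * (m / (t ^ 2 + m))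
  set I₂ := ∫ t in (0 : ℝ)..1, t ^ (2 - 2 * β - 1) * (m⁻¹ / (t ^ 2 + m⁻¹))
  set S₁ := ∑ i ∈ Finset.Icc 1 (dyadicLevels β r N), ∑ j ∈ Finset.Icc 1 N,
    ∑ k, A₁ i j k * (m / (t₁ i j k ^ 2 + m))
  set S₂ := ∑ i ∈ Finset.Icc 1 (dyadicLevels β r N), ∑ j ∈ Finset.Icc 1 N,
    ∑ k, A₂ i j k * (m⁻¹ / (t₂ i j k ^ 2 + m⁻¹))
  have h4 : m ^ β - 1 / Cbeta β * (S₁ + m * S₂) =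
      (Cbeta β)⁻¹ * ((I₁ - S₁) + m * (I₂ - S₂)) := by
    have h5 : m ^ β = (Cbeta β)⁻¹ * (I₁ + m * I₂) := by rw [← h3]; field_simp
    rw [h5]
    ring
  have h5 : BG 3 β μ r N = (Cbeta β)⁻¹ * (3 * ((N : ℝ) ^ (2 * r))⁻¹ / (2 * β) +
      μ * (3 * ((N : ℝ) ^ (2 * r))⁻¹ / (2 - 2 * β))) := by
    have h6 : (2 - 2 * β) = 2 * (1 - β) := by ring
    rw [BG, h6]
    ring
  rw [h4, h5, abs_mul, abs_of_pos (inv_pos.2 hC)]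
  refine mul_le_mul_of_nonneg_left ((abs_add_le _ _).trans (add_le_add e₁ ?_)) (inv_pos.2 hC).le
  rw [abs_mul, abs_of_pos hm]
  exact mul_le_mul hmμ e₂ (abs_nonneg _) (hm.le.trans hmμ)

end Dyadic

/-! ### The trapezoidal rule for functions analytic in a strip -/

section Strip

open Set Filter Topology Asymptotics FourierTransform

theorem integrable_exp_neg_mul_abs {δ : ℝ} (hδ : 0 < δ) :
    Integrable fun x : ℝ => Real.exp (-δ * |x|) := by
  rw [← integrableOn_univ, ← Iic_union_Ioi (a := (0 : ℝ))]
  refine IntegrableOn.union ?_ ?_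
  · refine (integrableOn_exp_mul_Iic hδ 0).congr_fun (fun x hx => ?_) measurableSet_Iic
    simp only [abs_of_nonpos (mem_Iic.1 hx), neg_mul_neg]
  · refine (integrableOn_exp_mul_Ioi (neg_lt_zero.2 hδ) 0).congr_fun (fun x hx => ?_)
      measurableSet_Ioi
    simp only [abs_of_pos (mem_Ioi.1 hx)]

theorem isBigO_exp_neg_mul_abs {δ : ℝ} (hδ : 0 < δ) :
    (fun x : ℝ => Real.exp (-δ * |x|)) =O[cocompact ℝ] fun x => |x| ^ (-2 : ℝ) :=
  (isLittleO_exp_neg_mul_rpow_atTop hδ (-2)).isBigO.comp_tendsto tendsto_norm_cocompact_atTop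

/-- `h` is complex differentiable at every point of the closed strip `|Im z| ≤ d` and bounded by
`B e^{-δ |Re z|}` there. -/
structure IsStripDecaying (h : ℂ → ℂ) (d δ B : ℝ) : Prop where
  differentiableAt : ∀ z : ℂ, |z.im| ≤ d → DifferentiableAt ℂ h z
  norm_le : ∀ z : ℂ, |z.im| ≤ d → ‖h z‖ ≤ B * Real.exp (-δ * |z.re|)

variable {h : ℂ → ℂ} {d δ B : ℝ}

theorem IsStripDecaying.continuous_line (hh : IsStripDecaying h d δ B) {c : ℝ} (hc : |c| ≤ d) :
    Continuous fun x : ℝ => h (x + c * Complex.I) := by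
  refine continuous_iff_continuousAt.2 fun x => ?_
  refine ContinuousAt.comp (f := fun x : ℝ => (x + c * Complex.I : ℂ))
    (hh.differentiableAt _ (by simpa using hc)).continuousAt (by fun_prop)

theorem IsStripDecaying.norm_line_le (hh : IsStripDecaying h d δ B) {c : ℝ} (hc : |c| ≤ d)
    (x : ℝ) : ‖h (x + c * Complex.I)‖ ≤ B * Real.exp (-δ * |x|) := by
  simpa using hh.norm_le (x + c * Complex.I) (by simpa using hc)

theorem IsStripDecaying.integrable_line (hh : IsStripDecaying h d δ B) (hδ : 0 < δ) {c : ℝ}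
    (hc : |c| ≤ d) : Integrable fun x : ℝ => h (x + c * Complex.I) :=
  ((integrable_exp_neg_mul_abs hδ).const_mul B).mono'
    (hh.continuous_line hc).aestronglyMeasurable (.of_forall (hh.norm_line_le hc))

theorem abs_le_of_mem_uIcc_zero {c d y : ℝ} (hc : |c| ≤ d) (hy : y ∈ uIcc 0 c) : |y| ≤ d := by
  have := abs_sub_left_of_mem_uIcc hy
  rw [sub_zero, sub_zero] at this
  exact this.trans hc

theorem IsStripDecaying.tendsto_vertical (hh : IsStripDecaying h d δ B) (hδ : 0 < δ) {c : ℝ}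
    (hc : |c| ≤ d) {l : Filter ℝ} {T : ℝ → ℝ} (hT : Tendsto (fun x => |T x|) l atTop) :
    Tendsto (fun x => ∫ y in (0 : ℝ)..c, h (T x + y * Complex.I)) l (𝓝 0) := by
  have h1 : Tendsto (fun x => B * Real.exp (-δ * |T x|) * |c - 0|) l (𝓝 0) := by
    have h2 : Tendsto (fun x => -δ * |T x|) l atBot :=
      hT.const_mul_atTop_of_neg (neg_lt_zero.2 hδ)
    have h3 := ((Real.tendsto_exp_atBot.comp h2).const_mul B).mul_const |c - 0|
    simpa using h3
  refine squeeze_zero_norm (fun x => ?_) h1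
  refine intervalIntegral.norm_integral_le_of_norm_le_const fun y hy => ?_
  exact hh.norm_line_le (abs_le_of_mem_uIcc_zero hc (uIoc_subset_uIcc hy)) (T x)

/-- Cauchy's theorem: the line of integration may be moved within the strip. -/
theorem IsStripDecaying.integral_line_eq (hh : IsStripDecaying h d δ B) (hδ : 0 < δ) {c : ℝ}
    (hc : |c| ≤ d) : ∫ x : ℝ, h (x + c * Complex.I) = ∫ x : ℝ, h x := by
  have hd : 0 ≤ d := (abs_nonneg c).trans hc
  have h0 : |(0 : ℝ)| ≤ d := by simpa using hd
  have hrect : ∀ T : ℝ, (∫ x in (-T)..T, h (x + (0 : ℝ) * Complex.I)) -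
      (∫ x in (-T)..T, h (x + c * Complex.I)) +
      Complex.I • (∫ y in (0 : ℝ)..c, h (T + y * Complex.I)) -
      Complex.I • (∫ y in (0 : ℝ)..c, h ((-T : ℝ) + y * Complex.I)) = 0 := by
    intro T
    have := Complex.integral_boundary_rect_eq_zero_of_differentiableOn h ((-T : ℝ) : ℂ)
      (T + c * Complex.I) ?_
    · simpa using this
    · intro z hz
      have hz2 : z.im ∈ uIcc 0 c := by simpa using hz.2
      exact (hh.differentiableAt z (abs_le_of_mem_uIcc_zero hc hz2)).differentiableWithinAt
  have hline : ∀ e : ℝ, |e| ≤ d → Tendsto (fun T : ℝ => ∫ x in (-T)..T, h (x + e * Complex.I))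
      atTop (𝓝 (∫ x : ℝ, h (x + e * Complex.I))) := fun e he =>
    intervalIntegral_tendsto_integral (hh.integrable_line hδ he) tendsto_neg_atTop_atBot tendsto_id
  have hv1 := hh.tendsto_vertical hδ hc (T := fun T => T) tendsto_abs_atTop_atTop
  have hv2 := hh.tendsto_vertical hδ hc (T := fun T => -T) (l := atTop)
    (by simpa only [abs_neg] using tendsto_abs_atTop_atTop)
  have hlim := (((hline 0 h0).sub (hline c hc)).add (hv1.const_smul Complex.I)).sub
    (hv2.const_smul Complex.I)
  have hlim0 := tendsto_nhds_unique hlim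
    (tendsto_const_nhds.congr fun T => (hrect T).symm)
  simp only [smul_zero, add_zero, sub_zero, Complex.ofReal_zero, zero_mul] at hlim0
  exact (sub_eq_zero.1 hlim0).symm

/-- Shifting the line of integration by `c` gains the factor `e^{2πξc}` in the Fourier integral. -/
theorem IsStripDecaying.norm_fourier_le (hh : IsStripDecaying h d δ B) (hδ : 0 < δ) {c : ℝ}
    (hc : |c| ≤ d) (ξ : ℝ) :
    ‖𝓕 (fun x : ℝ => h x) ξ‖ ≤
      Real.exp (2 * Real.pi * ξ * c) * ∫ x : ℝ, ‖h (x + c * Complex.I)‖ := by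
  have hexp : ∀ z : ℂ, ‖Complex.exp (-2 * Real.pi * ξ * Complex.I * z)‖ =
      Real.exp (2 * Real.pi * ξ * z.im) := by
    intro z
    rw [Complex.norm_exp]
    congr 1
    simp
  have hk : IsStripDecaying (fun z => Complex.exp (-2 * Real.pi * ξ * Complex.I * z) * h z) d δ
      (Real.exp (2 * Real.pi * |ξ| * d) * B) := by
    refine ⟨fun z hz => ?_, fun z hz => ?_⟩
    · exact DifferentiableAt.mul (by fun_prop) (hh.differentiableAt z hz)
    · rw [norm_mul, hexp, mul_assoc (Real.exp _)]
      refine mul_le_mul (Real.exp_le_exp.2 ?_) (hh.norm_le z hz) (norm_nonneg _)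
        (Real.exp_pos _).le
      rw [mul_assoc (2 * Real.pi), mul_assoc (2 * Real.pi)]
      refine mul_le_mul_of_nonneg_left ?_ (by positivity)
      refine (le_abs_self _).trans ?_
      rw [abs_mul]
      exact mul_le_mul_of_nonneg_left hz (abs_nonneg _)
  have h1 : 𝓕 (fun x : ℝ => h x) ξ =
      ∫ x : ℝ, Complex.exp (-2 * Real.pi * ξ * Complex.I * x) * h x := by
    rw [Real.fourier_real_eq_integral_exp_smul]
    congr 1 with x
    rw [smul_eq_mul]
    congr 2
    push_cast
    ring
  rw [h1, ← hk.integral_line_eq hδ hc, ← integral_const_mul]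
  refine (norm_integral_le_integral_norm _).trans_eq (integral_congr_ae (.of_forall fun x => ?_))
  simp only [norm_mul, hexp]
  simp

/-- The decay required for Poisson summation; the line is moved up or down according to the sign
of `ξ`. -/
theorem IsStripDecaying.isBigO_fourier (hh : IsStripDecaying h d δ B) (hδ : 0 < δ) (hd : 0 < d) :
    𝓕 (fun x : ℝ => h x) =O[cocompact ℝ] fun x => |x| ^ (-2 : ℝ) := by
  refine IsBigO.trans ?_ (isBigO_exp_neg_mul_abs (δ := 2 * Real.pi * d) (by positivity))
  refine IsBigO.of_bound (max (∫ x : ℝ, ‖h (x + (-d : ℝ) * Complex.I)‖)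
    (∫ x : ℝ, ‖h (x + d * Complex.I)‖)) (.of_forall fun ξ => ?_)
  rw [Real.norm_of_nonneg (Real.exp_pos _).le, mul_comm]
  have hdd : |d| ≤ d := (abs_of_pos hd).le
  rcases le_total 0 ξ with hξ | hξ
  · refine (hh.norm_fourier_le hδ (c := -d) (by rwa [abs_neg]) ξ).trans ?_
    rw [abs_of_nonneg hξ, show 2 * Real.pi * ξ * -d = -(2 * Real.pi * d) * ξ by ring]
    gcongr
    exact le_max_left _ _
  · refine (hh.norm_fourier_le hδ (c := d) hdd ξ).trans ?_
    rw [abs_of_nonpos hξ, show 2 * Real.pi * ξ * d = -(2 * Real.pi * d) * -ξ by ring]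
    gcongr
    exact le_max_right _ _

theorem hasSum_exp_neg_mul_succ {s : ℝ} (hs : 0 < s) :
    HasSum (fun n : ℕ => Real.exp (-(2 * s) * (n + 1))) (Real.exp (-s) / (2 * Real.sinh s)) := by
  have hr : Real.exp (-(2 * s)) < 1 := Real.exp_lt_one_iff.2 (by linarith)
  have h1 := (hasSum_geometric_of_lt_one (Real.exp_pos _).le hr).mul_left (Real.exp (-(2 * s)))
  convert! h1 using 1
  · ext n
    rw [← Real.exp_nat_mul, ← Real.exp_add]
    congr 1
    ring
  · have h2 : Real.sinh s ≠ 0 := (Real.sinh_pos_iff.2 hs).ne'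
    have h3 : 1 - Real.exp (-(2 * s)) ≠ 0 := by linarith
    have h4 : Real.exp (-(2 * s)) = Real.exp (-s) * Real.exp (-s) := by
      rw [← Real.exp_add]; congr 1; ring
    have h5 : Real.exp s * Real.exp (-s) = 1 := by rw [← Real.exp_add]; simp
    rw [← div_eq_mul_inv, div_eq_div_iff (by positivity) h3, Real.sinh_eq, h4]
    linear_combination (Real.exp (-s)) * (-h5)

/-- Error of the trapezoidal rule with unit step: by Poisson summation it is the sum of the Fourier
transform over the nonzero integers, where it decays like `e^{-2πd|n|}`. -/
theorem IsStripDecaying.norm_integral_sub_tsum_le (hh : IsStripDecaying h d δ B) (hδ : 0 < δ)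
    (hd : 0 < d) :
    ‖(∫ x : ℝ, h x) - ∑' n : ℤ, h ((n : ℝ) : ℂ)‖ ≤
      Real.exp (-(Real.pi * d)) / (2 * Real.sinh (Real.pi * d)) *
        ((∫ x : ℝ, ‖h (x + (-d : ℝ) * Complex.I)‖) + ∫ x : ℝ, ‖h (x + d * Complex.I)‖) := by
  have hdd : |d| ≤ d := (abs_of_pos hd).le
  have hc : Continuous fun x : ℝ => h x := by
    simpa using hh.continuous_line (c := 0) (by simpa using hd.le)
  have hO : (fun x : ℝ => h x) =O[cocompact ℝ] fun x => |x| ^ (-2 : ℝ) := by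
    refine IsBigO.trans (IsBigO.of_bound B (.of_forall fun x => ?_)) (isBigO_exp_neg_mul_abs hδ)
    rw [Real.norm_of_nonneg (Real.exp_pos _).le]
    simpa using hh.norm_line_le (c := 0) (by simpa using hd.le) x
  have hP := Real.tsum_eq_tsum_fourier_of_rpow_decay hc one_lt_two hO (hh.isBigO_fourier hδ hd) 0
  simp only [zero_add, fourier_eval_zero, AddCircle.coe_zero, mul_one] at hP
  have h0 : 𝓕 (fun x : ℝ => h x) 0 = ∫ x : ℝ, h x := by
    rw [Real.fourier_real_eq_integral_exp_smul]
    simp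
  have hs := hasSum_exp_neg_mul_succ (s := Real.pi * d) (by positivity)
  have hplus : ∀ n : ℕ, ‖𝓕 (fun x : ℝ => h x) ((n : ℝ) + 1)‖ ≤
      Real.exp (-(2 * (Real.pi * d)) * (n + 1)) *
        ∫ x : ℝ, ‖h (x + (-d : ℝ) * Complex.I)‖ := fun n => by
    refine (hh.norm_fourier_le hδ (c := -d) (by rwa [abs_neg]) _).trans_eq ?_
    congr 2
    ring
  have hminus : ∀ n : ℕ, ‖𝓕 (fun x : ℝ => h x) (-((n : ℝ) + 1))‖ ≤
      Real.exp (-(2 * (Real.pi * d)) * (n + 1)) * ∫ x : ℝ, ‖h (x + d * Complex.I)‖ := fun n => by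
    refine (hh.norm_fourier_le hδ (c := d) hdd _).trans_eq ?_
    congr 2
    ring
  have hS1 := Summable.of_norm_bounded (hs.summable.mul_right _) hplus
  have hS2 := Summable.of_norm_bounded (hs.summable.mul_right _) hminus
  have hS1' : Summable fun n : ℕ => 𝓕 (fun x : ℝ => h x) ((n : ℤ) : ℝ) := by
    rw [← summable_nat_add_iff 1]
    simpa using hS1
  have hsplit := tsum_of_nat_of_neg_add_one (f := fun n : ℤ => 𝓕 (fun x : ℝ => h x) (n : ℝ)) hS1'
    (by simpa using hS2)
  rw [hS1'.tsum_eq_zero_add] at hsplit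
  push_cast at hsplit
  rw [h0] at hsplit
  rw [hP, hsplit, add_assoc, sub_add_cancel_left, norm_neg, mul_add]
  refine (norm_add_le _ _).trans (add_le_add ?_ ?_)
  · exact tsum_of_norm_bounded (hs.mul_right _) hplus
  · exact tsum_of_norm_bounded (hs.mul_right _) hminus

end Strip

section StepSize

variable {h : ℂ → ℂ} {d δ B : ℝ}

theorem IsStripDecaying.comp_mul_left (hh : IsStripDecaying h d δ B) {k : ℝ} (hk : 0 < k) :
    IsStripDecaying (fun z => h (k * z)) (d / k) (k * δ) B := by
  have him : ∀ z : ℂ, |z.im| ≤ d / k → |((k : ℂ) * z).im| ≤ d := fun z hz => by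
    rw [Complex.im_ofReal_mul, abs_mul, abs_of_pos hk, mul_comm]
    rwa [le_div_iff₀ hk] at hz
  refine ⟨fun z hz => ?_, fun z hz => ?_⟩
  · exact (hh.differentiableAt _ (him z hz)).comp z (by fun_prop)
  · refine (hh.norm_le _ (him z hz)).trans_eq ?_
    rw [Complex.re_ofReal_mul, abs_mul, abs_of_pos hk]
    congr 2
    ring

/-- Error of the trapezoidal rule with step size `k`. -/
theorem IsStripDecaying.norm_integral_sub_trapezoid_le (hh : IsStripDecaying h d δ B) (hδ : 0 < δ)
    (hd : 0 < d) {k : ℝ} (hk : 0 < k) :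
    ‖(∫ x : ℝ, h x) - k * ∑' n : ℤ, h ((n * k : ℝ) : ℂ)‖ ≤
      Real.exp (-(Real.pi * d / k)) / (2 * Real.sinh (Real.pi * d / k)) *
        ((∫ x : ℝ, ‖h (x + (-d : ℝ) * Complex.I)‖) + ∫ x : ℝ, ‖h (x + d * Complex.I)‖) := by
  have h1 := (hh.comp_mul_left hk).norm_integral_sub_tsum_le (by positivity) (by positivity)
  have hscale : ∀ {E : Type} [NormedAddCommGroup E] [NormedSpace ℝ E] (f : ℝ → E),
      ∫ x : ℝ, f (k * x) = k⁻¹ • ∫ x : ℝ, f x := fun f => by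
    rw [Measure.integral_comp_mul_left, abs_of_pos (inv_pos.2 hk)]
  have h2 : ∫ x : ℝ, h (k * x) = k⁻¹ • ∫ x : ℝ, h x := by
    simpa using hscale fun x : ℝ => h x
  have h3 : ∀ c : ℝ, ∫ x : ℝ, ‖h (k * (x + (c / k : ℝ) * Complex.I))‖ =
      k⁻¹ * ∫ x : ℝ, ‖h (x + c * Complex.I)‖ := fun c => by
    refine Eq.trans ?_ (hscale fun x : ℝ => ‖h (x + c * Complex.I)‖)
    congr 1 with x
    congr 2
    have : (k : ℂ) ≠ 0 := by exact_mod_cast hk.ne'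
    push_cast
    field_simp
  rw [h2, h3, ← neg_div, h3, ← mul_add] at h1
  have h4 : (∫ x : ℝ, h x) - k * ∑' n : ℤ, h ((n * k : ℝ) : ℂ) =
      k • ((k⁻¹ • ∫ x : ℝ, h x) - ∑' n : ℤ, h (k * (n : ℝ))) := by
    rw [smul_sub, smul_inv_smul₀ hk.ne', Complex.real_smul]
    congr 3
    ext n
    push_cast
    rw [mul_comm]
  rw [h4, norm_smul, Real.norm_of_nonneg hk.le]
  refine (mul_le_mul_of_nonneg_left h1 hk.le).trans_eq ?_
  rw [mul_div_assoc, mul_left_comm, mul_inv_cancel_left₀ hk.ne']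

end StepSize

/-! ### The strip integrals of `g_λ` -/

section StripIntegral

open Set

variable {β lam : ℝ}

theorem re_one_add_exp_mul (z : ℂ) :
    (1 + Complex.exp (2 * z) * lam).re = 1 + Real.exp (2 * z.re) * lam * Real.cos (2 * z.im) := by
  simp [Complex.exp_re]
  ring

theorem im_one_add_exp_mul (z : ℂ) :
    (1 + Complex.exp (2 * z) * lam).im = Real.exp (2 * z.re) * lam * Real.sin (2 * z.im) := by
  simp [Complex.exp_im]
  ring

theorem cos_two_mul_nonneg {y : ℝ} (hy : |y| ≤ Real.pi / 4) : 0 ≤ Real.cos (2 * y) := by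
  have := abs_le.1 hy
  exact Real.cos_nonneg_of_mem_Icc ⟨by linarith, by linarith⟩

theorem one_le_norm_one_add_exp_mul (hlam : 0 < lam) {z : ℂ} (hz : |z.im| ≤ Real.pi / 4) :
    1 ≤ ‖1 + Complex.exp (2 * z) * lam‖ := by
  refine le_trans ?_ ((le_abs_self _).trans (Complex.abs_re_le_norm _))
  rw [re_one_add_exp_mul]
  have := cos_two_mul_nonneg hz
  exact le_add_of_nonneg_right (by positivity)

theorem exp_mul_le_norm_one_add_exp_mul (hlam : 0 < lam) {z : ℂ} (hz : |z.im| ≤ Real.pi / 4) :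
    Real.exp (2 * z.re) * lam ≤ ‖1 + Complex.exp (2 * z) * lam‖ := by
  refine le_of_sq_le_sq ?_ (norm_nonneg _)
  rw [← Complex.normSq_eq_norm_sq, Complex.normSq_apply, re_one_add_exp_mul, im_one_add_exp_mul]
  have h1 := cos_two_mul_nonneg hz
  have h2 : 0 ≤ Real.exp (2 * z.re) * lam * Real.cos (2 * z.im) := by positivity
  have h3 := Real.sin_sq_add_cos_sq (2 * z.im)
  have h4 : (1 + Real.exp (2 * z.re) * lam * Real.cos (2 * z.im)) *
      (1 + Real.exp (2 * z.re) * lam * Real.cos (2 * z.im)) +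
      Real.exp (2 * z.re) * lam * Real.sin (2 * z.im) *
        (Real.exp (2 * z.re) * lam * Real.sin (2 * z.im)) =
      1 + 2 * (Real.exp (2 * z.re) * lam * Real.cos (2 * z.im)) +
        (Real.exp (2 * z.re) * lam) ^ 2 := by
    linear_combination (Real.exp (2 * z.re) * lam) ^ 2 * h3
  rw [h4]
  linarith

theorem norm_gFun (β lam : ℝ) (z : ℂ) :
    ‖gFun β lam z‖ = Real.exp (2 * β * z.re) * ‖1 + Complex.exp (2 * z) * lam‖⁻¹ := by
  rw [gFun, norm_mul, norm_inv, Complex.norm_exp]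
  congr 2
  simp

theorem norm_gFun_le_exp (hlam : 0 < lam) {z : ℂ} (hz : |z.im| ≤ Real.pi / 4) :
    ‖gFun β lam z‖ ≤ Real.exp (2 * β * z.re) := by
  rw [norm_gFun]
  exact mul_le_of_le_one_right (Real.exp_pos _).le
    (inv_le_one_of_one_le₀ (one_le_norm_one_add_exp_mul hlam hz))

theorem norm_gFun_le_inv_mul_exp (hlam : 0 < lam) {z : ℂ} (hz : |z.im| ≤ Real.pi / 4) :
    ‖gFun β lam z‖ ≤ lam⁻¹ * Real.exp (-(2 - 2 * β) * z.re) := by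
  rw [norm_gFun]
  calc _ ≤ Real.exp (2 * β * z.re) * (Real.exp (2 * z.re) * lam)⁻¹ := by
        gcongr
        exact exp_mul_le_norm_one_add_exp_mul hlam hz
    _ = _ := by
        rw [mul_inv, ← Real.exp_neg, ← mul_assoc, ← Real.exp_add, mul_comm]
        congr 2
        ring

theorem isStripDecaying_gFun (hlam : 0 < lam) :
    IsStripDecaying (gFun β lam) (Real.pi / 4) (min (2 * β) (2 - 2 * β)) (max 1 lam⁻¹) := by
  refine ⟨fun z hz => ?_, fun z hz => ?_⟩
  · have h1 : 1 + Complex.exp (2 * z) * lam ≠ 0 :=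
      norm_pos_iff.1 (zero_lt_one.trans_le (one_le_norm_one_add_exp_mul hlam hz))
    unfold gFun
    fun_prop (disch := exact h1)
  · rcases le_total 0 z.re with h0 | h0
    · refine (norm_gFun_le_inv_mul_exp hlam hz).trans ?_
      rw [abs_of_nonneg h0]
      gcongr
      · exact le_max_right _ _
      · exact min_le_right _ _
    · refine (norm_gFun_le_exp hlam hz).trans ?_
      rw [abs_of_nonpos h0, neg_mul_neg]
      refine (Real.exp_le_exp.2 ?_).trans (le_mul_of_one_le_left (Real.exp_pos _).le
        (le_max_left _ _))
      exact mul_le_mul_of_nonpos_right (min_le_left _ _) h0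

theorem sub_I_mul_eq (y : ℝ) :
    (y - Complex.I * (Real.pi / 4) : ℂ) = y + (-(Real.pi / 4) : ℝ) * Complex.I := by
  push_cast; ring

theorem add_I_mul_eq (y : ℝ) :
    (y + Complex.I * (Real.pi / 4) : ℂ) = y + (Real.pi / 4 : ℝ) * Complex.I := by
  push_cast; ring

theorem min_two_mul_pos (hβ : 0 < β) (hβ1 : β < 1) : 0 < min (2 * β) (2 - 2 * β) :=
  lt_min (by linarith) (by linarith)

theorem abs_pi_div_four_le : |Real.pi / 4| ≤ Real.pi / 4 :=
  (abs_of_pos (by positivity)).le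

theorem stripIntegral_eq (hβ : 0 < β) (hβ1 : β < 1) (hlam : 0 < lam) :
    stripIntegral β lam =
      (∫ x : ℝ, ‖gFun β lam (x + (-(Real.pi / 4) : ℝ) * Complex.I)‖) +
        ∫ x : ℝ, ‖gFun β lam (x + (Real.pi / 4 : ℝ) * Complex.I)‖ := by
  have hh := isStripDecaying_gFun (β := β) hlam
  have hδ := min_two_mul_pos hβ hβ1
  simp only [stripIntegral, sub_I_mul_eq, add_I_mul_eq]
  exact integral_add (hh.integrable_line hδ (by rw [abs_neg]; exact abs_pi_div_four_le)).norm
    (hh.integrable_line hδ abs_pi_div_four_le).norm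

theorem norm_gFun_line_antitone {lam' : ℝ} (hlam : 0 < lam) (h : lam ≤ lam') {s : ℝ}
    (hs : Real.cos (2 * s) = 0) (x : ℝ) :
    ‖gFun β lam' (x + s * Complex.I)‖ ≤ ‖gFun β lam (x + s * Complex.I)‖ := by
  have hden : ∀ l : ℝ, Complex.normSq (1 + Complex.exp (2 * (x + s * Complex.I)) * l) =
      1 + (Real.exp (2 * x) * l * Real.sin (2 * s)) ^ 2 := fun l => by
    rw [Complex.normSq_apply, re_one_add_exp_mul, im_one_add_exp_mul]
    simp [hs]
    ring
  have hpos : 0 < ‖1 + Complex.exp (2 * (x + s * Complex.I)) * lam‖ := by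
    rw [norm_pos_iff, ← Complex.normSq_pos, hden]
    positivity
  rw [norm_gFun, norm_gFun]
  refine mul_le_mul_of_nonneg_left (inv_anti₀ hpos ?_) (Real.exp_pos _).le
  refine le_of_sq_le_sq ?_ (norm_nonneg _)
  rw [← Complex.normSq_eq_norm_sq, ← Complex.normSq_eq_norm_sq, hden, hden]
  have h1 : lam ^ 2 ≤ lam' ^ 2 := pow_le_pow_left₀ hlam.le h 2
  rw [mul_pow, mul_pow, mul_pow (_ * lam'), mul_pow _ lam']
  gcongr

/-- On the lines `Im z = ± π/4` the number `e^{2z}` is purely imaginary, so `|1 + λ e^{2z}|` increases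
in `λ`. -/
theorem stripIntegral_antitone (hβ : 0 < β) (hβ1 : β < 1) (hlam : 0 < lam) {lam' : ℝ}
    (h : lam ≤ lam') : stripIntegral β lam' ≤ stripIntegral β lam := by
  have hδ := min_two_mul_pos hβ hβ1
  have hlam' := hlam.trans_le h
  have hc : Real.cos (2 * (Real.pi / 4)) = 0 := by
    rw [show 2 * (Real.pi / 4) = Real.pi / 2 by ring, Real.cos_pi_div_two]
  have hc' : Real.cos (2 * -(Real.pi / 4)) = 0 := by rw [mul_neg, Real.cos_neg, hc]
  have ha : |-(Real.pi / 4)| ≤ Real.pi / 4 := by rw [abs_neg]; exact abs_pi_div_four_le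
  have hh := isStripDecaying_gFun (β := β) hlam
  have hh' := isStripDecaying_gFun (β := β) hlam'
  rw [stripIntegral_eq hβ hβ1 hlam, stripIntegral_eq hβ hβ1 hlam']
  refine add_le_add ?_ ?_
  · exact integral_mono (hh'.integrable_line hδ ha).norm (hh.integrable_line hδ ha).norm
      (norm_gFun_line_antitone hlam h hc')
  · exact integral_mono (hh'.integrable_line hδ abs_pi_div_four_le).norm
      (hh.integrable_line hδ abs_pi_div_four_le).norm (norm_gFun_line_antitone hlam h hc)

/-- The maximum `N(D_S)` over `λ ≥ λ₀` is attained at `λ₀`. -/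
theorem isGreatest_stripIntegral (hβ : 0 < β) (hβ1 : β < 1) (hlam : 0 < lam) :
    IsGreatest (stripIntegral β '' Ici lam) (stripIntegral β lam) ∧
      NDS β lam = stripIntegral β lam := by
  have h : IsGreatest (stripIntegral β '' Ici lam) (stripIntegral β lam) := by
    refine ⟨mem_image_of_mem _ self_mem_Ici, ?_⟩
    rintro _ ⟨l, hl, rfl⟩
    exact stripIntegral_antitone hβ hβ1 hlam hl
  exact ⟨h, h.csSup_eq⟩

theorem integral_norm_gFun_line_le (hβ : 0 < β) (hβ1 : β < 1) (hlam : 0 < lam) {c : ℝ}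
    (hc : |c| ≤ Real.pi / 4) :
    ∫ x : ℝ, ‖gFun β lam (x + c * Complex.I)‖ ≤ 1 / (2 * β) + lam⁻¹ / (2 - 2 * β) := by
  have hi := ((isStripDecaying_gFun (β := β) hlam).integrable_line
    (min_two_mul_pos hβ hβ1) hc).norm
  have hb : 0 < 2 - 2 * β := by linarith
  have hz : ∀ x : ℝ, |(x + c * Complex.I : ℂ).im| ≤ Real.pi / 4 := fun x => by simpa using hc
  rw [← intervalIntegral.integral_Iic_add_Ioi (b := 0) hi.integrableOn hi.integrableOn]
  refine add_le_add ?_ ?_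
  · have h1 := integral_exp_mul_Iic (a := 2 * β) (by linarith) 0
    rw [mul_zero, Real.exp_zero] at h1
    rw [← h1]
    refine integral_mono hi.integrableOn (integrableOn_exp_mul_Iic (by linarith) 0) fun x => ?_
    simpa using norm_gFun_le_exp (β := β) hlam (hz x)
  · have h1 := integral_exp_mul_Ioi (a := -(2 - 2 * β)) (by linarith) 0
    rw [mul_zero, Real.exp_zero, neg_div_neg_eq] at h1
    rw [div_eq_mul_one_div, ← h1, ← integral_const_mul]
    refine integral_mono hi.integrableOn
      ((integrableOn_exp_mul_Ioi (by linarith) 0).const_mul _) fun x => ?_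
    simpa using norm_gFun_le_inv_mul_exp (β := β) hlam (hz x)

theorem stripIntegral_le (hβ : 0 < β) (hβ1 : β < 1) (hlam : 0 < lam) :
    stripIntegral β lam ≤ 1 / β + lam⁻¹ / (1 - β) := by
  rw [stripIntegral_eq hβ hβ1 hlam]
  have h1 := integral_norm_gFun_line_le hβ hβ1 hlam abs_pi_div_four_le
  have h2 := integral_norm_gFun_line_le hβ hβ1 hlam (c := -(Real.pi / 4))
    (by rw [abs_neg]; exact abs_pi_div_four_le)
  refine (add_le_add h2 h1).trans_eq ?_
  have : 2 - 2 * β = 2 * (1 - β) := by ring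
  rw [this]
  have hb : 1 - β ≠ 0 := by linarith
  field_simp
  ring

end StripIntegral

/-! ### The truncated trapezoidal rule in `y = ln t` -/

section Trapezoid

open Set

theorem gFun_ofReal (β lam y : ℝ) :
    gFun β lam y = ((Real.exp (2 * β * y) * (1 + Real.exp y ^ 2 * lam)⁻¹ : ℝ) : ℂ) := by
  rw [gFun, ← Real.exp_nat_mul]
  push_cast
  rfl

theorem integral_gFun_eq {β m : ℝ} (hm : 0 < m) :
    ∫ y : ℝ, gFun β m⁻¹ y = ((m ^ β * Cbeta β : ℝ) : ℂ) := by
  rw [← integral_Ioi_eq_rpow_mul_Cbeta hm, ← Real.range_exp, ← image_univ,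
    integral_image_eq_integral_abs_deriv_smul MeasurableSet.univ
      (fun x _ => (Real.hasDerivAt_exp x).hasDerivWithinAt) Real.exp_injective.injOn,
    setIntegral_univ, ← integral_complex_ofReal]
  congr 1 with y
  rw [gFun_ofReal, abs_of_pos (Real.exp_pos y), smul_eq_mul, ← mul_assoc, ← Real.exp_mul,
    ← Real.exp_add]
  congr 4
  ring

/-- A geometric tail is bounded by the corresponding integral of `e^{-ax}`. -/
theorem mul_tsum_tail_le {a k K : ℝ} (ha : 0 < a) (hk : 0 < k) {N : ℕ} {F : ℕ → ℝ}
    (hF0 : ∀ n, 0 ≤ F n) (hF : ∀ n : ℕ, F n ≤ K * Real.exp (-a * ((n + N + 1) * k))) :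
    Summable F ∧ k * ∑' n, F n ≤ K / a * Real.exp (-(a * (N * k))) := by
  have hak : 0 < a * k := mul_pos ha hk
  have hr : Real.exp (-(a * k)) < 1 := Real.exp_lt_one_iff.2 (by linarith)
  have hK : 0 ≤ K := by
    have := (hF0 0).trans (hF 0)
    exact nonneg_of_mul_nonneg_left this (Real.exp_pos _)
  have hg := (hasSum_geometric_of_lt_one (Real.exp_pos _).le hr).mul_left
    (K * Real.exp (-a * ((N + 1) * k)))
  have hle : ∀ n, F n ≤ K * Real.exp (-a * ((N + 1) * k)) * Real.exp (-(a * k)) ^ n := fun n => by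
    refine (hF n).trans_eq ?_
    rw [← Real.exp_nat_mul, mul_assoc, ← Real.exp_add]
    congr 2
    ring
  have hs := Summable.of_nonneg_of_le hF0 hle hg.summable
  refine ⟨hs, ?_⟩
  have h1 : ∑' n, F n ≤ _ := hs.tsum_le_of_sum_le fun s =>
    (Finset.sum_le_sum fun n _ => hle n).trans (sum_le_hasSum s (fun n _ => by positivity) hg)
  refine (mul_le_mul_of_nonneg_left h1 hk.le).trans ?_
  -- `k / (e^{ak} - 1) ≤ 1 / a`
  have h2 : a * k * Real.exp (-(a * k)) ≤ 1 - Real.exp (-(a * k)) := by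
    have h3 := Real.add_one_le_exp (a * k)
    have h4 : Real.exp (a * k) * Real.exp (-(a * k)) = 1 := by rw [← Real.exp_add]; simp
    nlinarith [Real.exp_pos (-(a * k))]
  have h5 : Real.exp (-a * ((N + 1) * k)) = Real.exp (-(a * (N * k))) * Real.exp (-(a * k)) := by
    rw [← Real.exp_add]
    congr 1
    ring
  have h6 : 0 < 1 - Real.exp (-(a * k)) := by linarith
  rw [h5, ← div_eq_mul_inv, mul_div_assoc', div_le_iff₀ h6]
  have h7 := mul_le_mul_of_nonneg_left h2
    (show 0 ≤ K / a * Real.exp (-(a * (N * k))) by positivity)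
  refine le_trans (le_of_eq ?_) h7
  field_simp

theorem sum_Icc_neg_self (f : ℤ → ℝ) (N : ℕ) :
    ∑ l ∈ Finset.Icc (-(N : ℤ)) N, f l =
      ∑ n ∈ Finset.range (N + 1), f n + ∑ n ∈ Finset.range N, f (-((n : ℤ) + 1)) := by
  induction N with
  | zero => simp
  | succ N ih =>
    have h : Finset.Icc (-((N + 1 : ℕ) : ℤ)) ((N + 1 : ℕ) : ℤ) =
        insert ((N : ℤ) + 1) (insert (-((N : ℤ) + 1)) (Finset.Icc (-(N : ℤ)) N)) := by
      ext x
      simp only [Finset.mem_Icc, Finset.mem_insert]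
      omega
    have h1 : (N : ℤ) + 1 ∉ insert (-((N : ℤ) + 1)) (Finset.Icc (-(N : ℤ)) N) := by
      simp only [Finset.mem_Icc, Finset.mem_insert]
      omega
    have h2 : -((N : ℤ) + 1) ∉ Finset.Icc (-(N : ℤ)) N := by
      simp only [Finset.mem_Icc]
      omega
    rw [h, Finset.sum_insert h1, Finset.sum_insert h2, ih, 
      Finset.sum_range_succ (fun n : ℕ => f n) (N + 1),
      Finset.sum_range_succ (fun n : ℕ => f (-((n : ℤ) + 1))) N]
    push_cast
    ring

theorem tsum_int_eq_sum_Icc_add_tails {f : ℤ → ℝ} {N : ℕ}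
    (h₁ : Summable fun n : ℕ => f ((n : ℤ) + N + 1))
    (h₂ : Summable fun n : ℕ => f (-((n : ℤ) + N + 1))) :
    ∑' l, f l = ∑ l ∈ Finset.Icc (-(N : ℤ)) N, f l +
      (∑' n : ℕ, f ((n : ℤ) + N + 1) + ∑' n : ℕ, f (-((n : ℤ) + N + 1))) := by
  have e₁ : ∀ n : ℕ, f ((n : ℤ) + N + 1) = f ((n + (N + 1) : ℕ) : ℤ) := fun n => by
    push_cast; rw [add_assoc]
  have e₂ : ∀ n : ℕ, f (-((n : ℤ) + N + 1)) = f (-(((n + N : ℕ) : ℤ) + 1)) := fun n => by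
    push_cast; rfl
  simp only [e₁, e₂] at h₁ h₂ ⊢
  have s₁ := (summable_nat_add_iff (f := fun n : ℕ => f n) (N + 1)).1 h₁
  have s₂ := (summable_nat_add_iff (f := fun n : ℕ => f (-((n : ℤ) + 1))) N).1 h₂
  rw [tsum_of_nat_of_neg_add_one s₁ s₂, sum_Icc_neg_self, ← s₁.sum_add_tsum_nat_add (N + 1),
    ← s₂.sum_add_tsum_nat_add N]
  ring

theorem abs_rpow_sub_trapezoid_le {β m μ : ℝ} (hβ : 0 < β) (hβ1 : β < 1) (hm : 0 < m)
    (hmμ : m ≤ μ) {N : ℕ} (hN : 1 ≤ N) :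
    |m ^ β - meshSize N / Cbeta β * ∑ l ∈ Finset.Icc (-(N : ℤ)) N,
      Real.exp (2 * β * (l * meshSize N)) * (1 + Real.exp (l * meshSize N) ^ 2 * m⁻¹)⁻¹| ≤
      BE β μ N := by
  have hC := Cbeta_pos hβ hβ1
  have hm' := inv_pos.2 hm
  have hμ : 0 < μ := hm.trans_le hmμ
  have hN0 : (0 : ℝ) < √N := Real.sqrt_pos.2 (by exact_mod_cast hN)
  have hb : 0 < 2 - 2 * β := by linarith
  set k := meshSize N with hkdef
  have hk : 0 < k := by rw [hkdef, meshSize]; positivity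
  have hNk : (N : ℝ) * k = k⁻¹ := by
    rw [hkdef, meshSize, one_div, inv_inv, ← div_eq_mul_inv, Real.div_sqrt]
  set G : ℝ → ℝ := fun y => Real.exp (2 * β * y) * (1 + Real.exp y ^ 2 * m⁻¹)⁻¹ with hG
  have hG0 : ∀ y, 0 ≤ G y := fun y => by positivity
  have hGnorm : ∀ y, G y = ‖gFun β m⁻¹ y‖ := fun y => by
    rw [gFun_ofReal, Complex.norm_real, Real.norm_of_nonneg (hG0 y)]
  have him : ∀ y : ℝ, |(y : ℂ).im| ≤ Real.pi / 4 := fun y => by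
    rw [Complex.ofReal_im, abs_zero]; positivity
  have hG1 : ∀ y, G y ≤ Real.exp (2 * β * y) := fun y => by
    rw [hGnorm]
    exact norm_gFun_le_exp hm' (him y)
  have hG2 : ∀ y, G y ≤ m * Real.exp (-(2 - 2 * β) * y) := fun y => by
    rw [hGnorm]
    simpa using norm_gFun_le_inv_mul_exp (β := β) hm' (him y)
  obtain ⟨s₁, t₁⟩ := mul_tsum_tail_le (N := N) (K := m) hb hk
    (F := fun n : ℕ => G ((((n : ℤ) + N + 1 : ℤ) : ℝ) * k)) (fun n => hG0 _) (fun n => by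
      refine (hG2 _).trans_eq ?_
      push_cast
      rfl)
  obtain ⟨s₂, t₂⟩ := mul_tsum_tail_le (N := N) (a := 2 * β) (K := 1) (by linarith) hk
    (F := fun n : ℕ => G (((-((n : ℤ) + N + 1) : ℤ) : ℝ) * k)) (fun n => hG0 _) (fun n => by
      refine (hG1 _).trans_eq ?_
      rw [one_mul]
      push_cast
      congr 1
      ring)
  have hsplit := tsum_int_eq_sum_Icc_add_tails (f := fun l : ℤ => G (l * k)) (N := N) s₁ s₂
  have htrap := (isStripDecaying_gFun (β := β) hm').norm_integral_sub_trapezoid_le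
    (min_two_mul_pos hβ hβ1) (by positivity) hk
  rw [← stripIntegral_eq hβ hβ1 hm', integral_gFun_eq hm] at htrap
  simp only [gFun_ofReal] at htrap
  rw [← Complex.ofReal_tsum, ← Complex.ofReal_mul, ← Complex.ofReal_sub, Complex.norm_real,
    Real.norm_eq_abs] at htrap
  change |m ^ β * Cbeta β - k * ∑' l : ℤ, G (l * k)| ≤ _ at htrap
  have hpi : Real.pi * (Real.pi / 4) / k = Real.pi ^ 2 / (4 * k) := by
    field_simp
  have hsinh : 0 < Real.sinh (Real.pi ^ 2 / (4 * k)) := Real.sinh_pos_iff.2 (by positivity)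
  rw [hpi] at htrap
  have hNDS : stripIntegral β m⁻¹ ≤ NDS β μ⁻¹ := by
    rw [(isGreatest_stripIntegral hβ hβ1 (inv_pos.2 hμ)).2]
    exact stripIntegral_antitone hβ hβ1 (inv_pos.2 hμ) (inv_anti₀ hm hmμ)
  change |m ^ β - k / Cbeta β * ∑ l ∈ Finset.Icc (-(N : ℤ)) N, G (l * k)| ≤ _
  set S := ∑ l ∈ Finset.Icc (-(N : ℤ)) N, G (l * k)
  set T₁ := ∑' n : ℕ, G ((((n : ℤ) + N + 1 : ℤ) : ℝ) * k)
  set T₂ := ∑' n : ℕ, G (((-((n : ℤ) + N + 1) : ℤ) : ℝ) * k)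
  rw [hsplit] at htrap
  have h1 : m ^ β - k / Cbeta β * S = (Cbeta β)⁻¹ *
      ((m ^ β * Cbeta β - k * (S + (T₁ + T₂))) + (k * T₁ + k * T₂)) := by
    field_simp
    ring
  have hT₁ : 0 ≤ k * T₁ := mul_nonneg hk.le (tsum_nonneg fun n => hG0 _)
  have hT₂ : 0 ≤ k * T₂ := mul_nonneg hk.le (tsum_nonneg fun n => hG0 _)
  rw [h1, abs_mul, abs_of_pos (inv_pos.2 hC), BE, one_div (Cbeta β), ← hkdef]
  refine mul_le_mul_of_nonneg_left ((abs_add_le _ _).trans ?_) (inv_pos.2 hC).le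
  rw [abs_of_nonneg (add_nonneg hT₁ hT₂)]
  rw [hNk, ← div_eq_mul_inv] at t₁ t₂
  have h2 : Real.exp (-(Real.pi ^ 2 / (4 * k))) / (2 * Real.sinh (Real.pi ^ 2 / (4 * k))) *
      stripIntegral β m⁻¹ ≤ NDS β μ⁻¹ / (2 * Real.sinh (Real.pi ^ 2 / (4 * k))) *
        Real.exp (-(Real.pi ^ 2 / (4 * k))) := by
    rw [div_mul_eq_mul_div, div_mul_eq_mul_div, mul_comm]
    gcongr
  have h3 : m / (2 - 2 * β) * Real.exp (-((2 - 2 * β) / k)) ≤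
      μ / (2 - 2 * β) * Real.exp (-((2 - 2 * β) / k)) := by
    gcongr
  linarith

end Trapezoid

/-! ### The operator error bounds -/

section OperatorBounds

variable {𝕜 : Type*} [RCLike 𝕜] {H : Type*} [NormedAddCommGroup H] [InnerProductSpace 𝕜 H]
  [FiniteDimensional 𝕜 H] [Nontrivial H]

/-- If `Q` acts on every eigenvector of `T` with eigenvalue `m` as the scalar `q m`, the error
`T^β - Q` is controlled by the scalar errors `m^β - q m` over `0 < m ≤ μ`. -/
theorem opNorm₀_powT_sub_le (ip₁ : InnerProductSpace.Core 𝕜 H) {β B : ℝ} {Q : H →ₗ[𝕜] H}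
    {q : ℝ → ℝ}
    (hQ : ∀ m : ℝ, 0 < m → ∀ ψ : H, opT ip₁ ψ = (m : 𝕜) • ψ → Q ψ = (q m : 𝕜) • ψ)
    (hB : ∀ m : ℝ, 0 < m → m ≤ maxEigenvalue ip₁ → |m ^ β - q m| ≤ B) :
    opNorm₀ (powT ip₁ β - Q) ≤ B := by
  refine opNorm₀_le_of_diagonal ((opT_isSymmetric ip₁).eigenvectorBasis rfl) _
    (fun i => (opT_isSymmetric ip₁).eigenvalues rfl i ^ β -
      q ((opT_isSymmetric ip₁).eigenvalues rfl i)) (fun i => ?_) ?_ (fun i => ?_)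
  · rw [LinearMap.sub_apply, powT_eigenvector,
      hQ _ (eigenvalues_opT_pos ip₁ i) _ (opT_eigenvector ip₁ i), ← sub_smul, RCLike.ofReal_sub]
  · exact (abs_nonneg _).trans (hB _ (maxEigenvalue_pos ip₁) le_rfl)
  · exact hB _ (eigenvalues_opT_pos ip₁ i) (eigenvalues_le_maxEigenvalue ip₁ i)

theorem opNorm₀_powT_sub_QR_le (ip₁ : InnerProductSpace.Core 𝕜 H) {β : ℝ} (hβ : 0 < β)
    (hβ1 : β < 1) {N : ℕ} (hN : 1 ≤ N) {s₁ s₂ : ℕ → ℝ} (hs₁ : IsSampling (2 * β)⁻¹ N s₁)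
    (hs₂ : IsSampling (2 - 2 * β)⁻¹ N s₂) :
    opNorm₀ (powT ip₁ β - QR ip₁ β N s₁ s₂) ≤ BR β (maxEigenvalue ip₁) N := by
  refine opNorm₀_powT_sub_le ip₁ (fun m hm ψ hψ => ?_)
    fun m hm hmμ => abs_rpow_sub_rectangle_le hβ hβ1 hm hmμ hN hs₁ hs₂
  have hpos : ∀ i ∈ Finset.range N, 0 < s₂ i := fun i hi =>
    (Real.rpow_nonneg (by positivity) _).trans_lt (hs₂ i (Finset.mem_range.1 hi)).1
  rw [QR, LinearMap.smul_apply, LinearMap.sum_apply, RCLike.ofReal_mul, mul_smul,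
    RCLike.ofReal_sum, Finset.sum_smul]
  congr 1
  refine Finset.sum_congr rfl fun i hi => ?_
  simp only [LinearMap.add_apply, LinearMap.smul_apply, opT₁_apply_of_eigenvector ip₁ hm hψ,
    opT₂_apply_of_eigenvector ip₁ hm hψ (hpos i hi), RCLike.ofReal_add, RCLike.ofReal_mul,
    add_smul, mul_smul]

theorem opNorm₀_powT_sub_QG_le (ip₁ : InnerProductSpace.Core 𝕜 H) {β : ℝ} (hβ : 0 < β)
    (hβ1 : β < 1) {N r : ℕ} (hN : 1 ≤ N) (hr : 1 ≤ r) {t₁ A₁ t₂ A₂ : ℕ → ℕ → Fin r → ℝ}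
    (h₁ : IsDyadicGauss (fun x => x ^ (2 * β - 1)) (dyadicLevels β r N) N r t₁ A₁)
    (h₂ : IsDyadicGauss (fun x => x ^ (1 - 2 * β)) (dyadicLevels β r N) N r t₂ A₂) :
    opNorm₀ (powT ip₁ β - QG ip₁ β (dyadicLevels β r N) N r t₁ A₁ t₂ A₂) ≤
      BG 3 β (maxEigenvalue ip₁) r N := by
  refine opNorm₀_powT_sub_le ip₁ (fun m hm ψ hψ => ?_)
    fun m hm hmμ => abs_rpow_sub_gauss_le hβ hβ1 hm hmμ hN hr h₁ h₂
  rw [QG, LinearMap.smul_apply, RCLike.ofReal_mul, mul_smul]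
  simp only [LinearMap.sum_apply, RCLike.ofReal_sum, Finset.sum_smul]
  congr 1
  refine Finset.sum_congr rfl fun i hi => Finset.sum_congr rfl fun j hj =>
    Finset.sum_congr rfl fun k _ => ?_
  have hpos : 0 < t₂ i j k := (dyadicPoint_pos N i (j - 1)).trans_le ((h₂ i hi j hj).2.1 k).1
  simp only [LinearMap.add_apply, LinearMap.smul_apply, opT₁_apply_of_eigenvector ip₁ hm hψ,
    opT₂_apply_of_eigenvector ip₁ hm hψ hpos, RCLike.ofReal_add, RCLike.ofReal_mul,
    add_smul, mul_smul]

theorem opNorm₀_powT_sub_QE_le (ip₁ : InnerProductSpace.Core 𝕜 H) {β : ℝ} (hβ : 0 < β)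
    (hβ1 : β < 1) {N : ℕ} (hN : 1 ≤ N) :
    opNorm₀ (powT ip₁ β - QE ip₁ β N) ≤ BE β (maxEigenvalue ip₁) N := by
  refine opNorm₀_powT_sub_le ip₁ (fun m hm ψ hψ => ?_)
    fun m hm hmμ => abs_rpow_sub_trapezoid_le hβ hβ1 hm hmμ hN
  rw [QE, LinearMap.smul_apply, LinearMap.sum_apply, RCLike.ofReal_mul, mul_smul,
    RCLike.ofReal_sum, Finset.sum_smul]
  congr 1
  refine Finset.sum_congr rfl fun l _ => ?_
  rw [LinearMap.smul_apply, opT₁_apply_of_eigenvector ip₁ hm hψ, RCLike.ofReal_mul, mul_smul]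

end OperatorBounds

end FractionalQuadrature

theorem theorem3p1 :
    ∃ C_G : ℕ → ℝ,
      ∀ (𝕜 : Type u) [RCLike 𝕜] (H : Type v) [NormedAddCommGroup H] [InnerProductSpace 𝕜 H]
        [FiniteDimensional 𝕜 H] [Nontrivial H] (ip₁ : InnerProductSpace.Core 𝕜 H)
        (β : ℝ), 0 < β → β < 1 → ∀ N : ℕ, 1 ≤ N →
        -- rectangle rule on graded meshes
        (∀ s₁ s₂ : ℕ → ℝ,
          IsSampling ((2 * β)⁻¹) N s₁ → IsSampling ((2 - 2 * β)⁻¹) N s₂ →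
          opNorm₀ (powT ip₁ β - QR ip₁ β N s₁ s₂) ≤ BR β (maxEigenvalue ip₁) N) ∧
        -- Gaussian rules on the dyadic partition: they exist, and the error bound holds
        (∀ r : ℕ, 1 ≤ r →
          (∃ t₁ A₁, IsDyadicGauss (fun x => x ^ (2 * β - 1)) (dyadicLevels β r N) N r t₁ A₁) ∧
          (∃ t₂ A₂, IsDyadicGauss (fun x => x ^ (1 - 2 * β)) (dyadicLevels β r N) N r t₂ A₂) ∧
          ∀ t₁ A₁ t₂ A₂ : ℕ → ℕ → Fin r → ℝ,
            IsDyadicGauss (fun x => x ^ (2 * β - 1)) (dyadicLevels β r N) N r t₁ A₁ →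
            IsDyadicGauss (fun x => x ^ (1 - 2 * β)) (dyadicLevels β r N) N r t₂ A₂ →
            opNorm₀ (powT ip₁ β - QG ip₁ β (dyadicLevels β r N) N r t₁ A₁ t₂ A₂) ≤
              BG (C_G r) β (maxEigenvalue ip₁) r N) ∧
        -- trapezoidal rule after the substitution `y = ln t`; `N(D_S)` is a maximum
        (IsGreatest (stripIntegral β '' Set.Ici (maxEigenvalue ip₁)⁻¹)
            (NDS β (maxEigenvalue ip₁)⁻¹) ∧
          NDS β (maxEigenvalue ip₁)⁻¹ ≤ 1 / β + maxEigenvalue ip₁ / (1 - β) ∧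
          opNorm₀ (powT ip₁ β - QE ip₁ β N) ≤ BE β (maxEigenvalue ip₁) N) := by
  refine ⟨fun _ => 3, fun 𝕜 _ H _ _ _ _ ip₁ β hβ hβ1 N hN => ⟨fun s₁ s₂ hs₁ hs₂ =>
    opNorm₀_powT_sub_QR_le ip₁ hβ hβ1 hN hs₁ hs₂, fun r hr =>
    ⟨exists_isDyadicGauss _ hN _ r, exists_isDyadicGauss _ hN _ r, fun t₁ A₁ t₂ A₂ h₁ h₂ =>
      opNorm₀_powT_sub_QG_le ip₁ hβ hβ1 hN hr h₁ h₂⟩, ?_, ?_,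
    opNorm₀_powT_sub_QE_le ip₁ hβ hβ1 hN⟩⟩
  · obtain ⟨h1, h2⟩ := isGreatest_stripIntegral hβ hβ1 (inv_pos.2 (maxEigenvalue_pos ip₁))
    rw [h2]
    exact h1
  · rw [(isGreatest_stripIntegral hβ hβ1 (inv_pos.2 (maxEigenvalue_pos ip₁))).2]
    simpa using stripIntegral_le hβ hβ1 (inv_pos.2 (maxEigenvalue_pos ip₁))
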